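/- **Model.** The state $\omega\in\{0,1\}$ is binary; beliefs are identified with the probability $\mu\in[0,1]$ of $\omega=1$. Actions lie in a nonempty compact metric space $A$, private types in a compact metric space $\Theta$; in state $\omega$ the type has law $f_\omega$; the utility $u(a,\omega,\theta)$ is bounded, measurable and continuous in $a$. A private strategy is a measurable map $\hat\sigma:\Theta\to\Delta(A)$; $U(\hat\sigma,\mu)$ is its expected payoff when $\omega\sim\mu$; it is *Bayes-optimal* for $\mu$ if it maximizes $U(\cdot,\mu)$; and $U(\mu)=\sup_{\hat\sigma}U(\hat\sigma,\mu)$. The adviser's posterior has a strictly positive probability density $\tau$ on $[0,1]$, the prior is $\mu_0=\int_0^1\mu\,\tau(\mu)\,d\mu$, and the posterior and the type are independent conditionally on the state. Let $\alpha\in[0,1]$. With probability $\alpha$ the adviser reports his posterior truthfully; otherwise he uses a strategy $\beta:[0,1]\to\Delta([0,1])$. A strategy $\sigma=(\hat\sigma(m))_{m\in[0,1]}$ of the agent prescribes, measurably, a private strategy after each message $m$. Its worst-case payoff is $U(\sigma)=\alpha\,\mathbb E_{\mathrm{id},\sigma}[u]+(1-\alpha)\inf_\beta\mathbb E_{\beta,\sigma}[u]$;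 $\sigma$ is *optimal* if it maximizes this, and $\beta$ is *adversarial* against $\sigma$ if it attains the infimum. The strategy $\sigma$ is *robustly rationalizable* if for some $\beta$ that is adversarial against $\sigma$, after almost every message $m$ (under the law of messages when the misaligned adviser plays $\beta$) $\hat\sigma(m)$ is Bayes-optimal for the Bayesian posterior given $m$. It is a *trust region strategy* with compact trust region $T\subseteq[0,1]$ if $\hat\sigma(m)$ is Bayes-optimal for $m$ whenever $m\in T$, and, whenever $m\notin T$, $\hat\sigma(m)$ is Bayes-optimal for some $P(m)\in\arg\max_{m'\in T}U(\hat\sigma(m'),m)$. **Proposition.** Suppose that $U$ is strictly convex and twice differentiable on $[0,1]$ (one-sidedly at the end points). For $\underline\mu<\overline\mu$ put $b(\underline\mu,\overline\mu)=\int_{\underline\mu}^{\overline\mu}\mu U''(\mu)\,d\mu\big/\int_{\underline\mu}^{\overline\mu}U''(\mu)\,d\mu$, and $b(\mu,\mu)=\mu$. Consider the balancing conditions, with $b=b(\underline\mu,\overline\mu)$, $$\frac{\alpha\int_0^{\underline\mu}\mu\tau(\mu)\,d\mu+(1-\alpha)\int_b^1\mu\tau(\mu)\,d\mu}{\alpha\int_0^{\underline\mu}\tau(\mu)\,d\mu+(1-\alpha)\int_b^1\tau(\mu)\,d\mu}=\underline\mu,\qquad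 \frac{\alpha\int_{\overline\mu}^1\mu\tau(\mu)\,d\mu+(1-\alpha)\int_0^b\mu\tau(\mu)\,d\mu}{\alpha\int_{\overline\mu}^1\tau(\mu)\,d\mu+(1-\alpha)\int_0^b\tau(\mu)\,d\mu}=\overline\mu,\qquad(\ast)$$ read with the denominators multiplied out; if $\alpha<1$, both denominators are positive for all $0\le\underline\mu\le\mu_0\le\overline\mu\le1$. Then there is an interval $T=[\underline\mu,\overline\mu]$ with $0\le\underline\mu\le\mu_0\le\overline\mu\le1$ such that: 1. If $\alpha\le1/2$, then $T=\{\mu_0\}$. If $\alpha>1/2$, then $(\underline\mu,\overline\mu)$ is the unique solution of $(\ast)$ with $0\le\underline\mu\le\mu_0\le\overline\mu\le1$. 2. There is an optimal strategy that is robustly rationalizable and is a trust region strategy with trust region $T$. If $\alpha<1$, every optimal strategy is robustly rationalizable. 3. Whenever an optimal strategy is a trust region strategy with some trust region $T'$, then $T'=T$. 4. The optimal strategy is unique in the following sense. If $\sigma$ is optimal, then for almost every $m\in[0,1]$, $\hat\sigma(m)$ is Bayes-optimal for the point of $T$ nearest to $m$. Any two optimal strategies have, for almost every $m$, the same expected payoff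 in each state after $m$. If moreover for every belief in $(0,1)$ the Bayes-optimal private strategy is unique up to $f_\omega$-null sets of types (for both $\omega$), then any two optimal strategies coincide for almost every $m$ and, in each state $\omega$, $f_\omega$-almost every $\theta$. -/

import Mathlib

open MeasureTheory ProbabilityTheory Set
open scoped ENNReal

noncomputable section

namespace TrustRegion

/-- Weights of the two states `0`, `1` under the belief that gives probability `μ` to state `1`. -/
def weight (μ : ℝ) (ω : Fin 2) : ℝ := ![1 - μ, μ] ω

/-- The agent's decision problem with a binary state: a utility `u a ω θ`, bounded, measurable and
continuous in the action, and the law `f ω` of the agent's private type in state `ω`. -/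
structure DecisionProblem (A Θ : Type*) [TopologicalSpace A] [MeasurableSpace A]
    [MeasurableSpace Θ] where
  u : A → Fin 2 → Θ → ℝ
  f : Fin 2 → Measure Θ
  isProb : ∀ ω, IsProbabilityMeasure (f ω)
  measurable_u : ∀ ω, Measurable fun p : A × Θ => u p.1 ω p.2
  continuous_u : ∀ ω θ, Continuous fun a => u a ω θ
  bounded_u : ∃ C : ℝ, ∀ a ω θ, |u a ω θ| ≤ C

/-- A private strategy: a measurable map from types to lotteries over actions. -/
abbrev PrivateStrategy (A Θ : Type*) [MeasurableSpace A] [MeasurableSpace Θ] : Type _ :=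
  {κ : Kernel Θ A // IsMarkovKernel κ}

/-- A strategy of the agent: a measurable map from messages (beliefs in `[0, 1]`) and types to
lotteries over actions. -/
abbrev Strategy (A Θ : Type*) [MeasurableSpace A] [MeasurableSpace Θ] : Type _ :=
  {σ : Kernel (unitInterval × Θ) A // IsMarkovKernel σ}

/-- A strategy of the misaligned adviser: a measurable map from his posterior belief to
distributions over messages. -/
abbrev AdviserStrategy : Type := {β : Kernel unitInterval unitInterval // IsMarkovKernel β}

/-- The aligned adviser reports his belief truthfully. -/
def truthful : AdviserStrategy := ⟨Kernel.id, inferInstance⟩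

/-- The private strategy that `σ` prescribes after the message `m`. -/
def Strategy.after {A Θ : Type*} [MeasurableSpace A] [MeasurableSpace Θ]
    (σ : Strategy A Θ) (m : unitInterval) : PrivateStrategy A Θ :=
  ⟨σ.1.comap (fun θ => (m, θ)) measurable_prodMk_left, by
    have := σ.2
    infer_instance⟩

/-- `τ` is a strictly positive probability density on `[0, 1]`. -/
structure IsPositiveDensity (τ : ℝ → ℝ) : Prop where
  measurable : Measurable τ
  pos : ∀ x ∈ Icc (0 : ℝ) 1, 0 < τ x
  integral_eq_one : ∫ x in (0 : ℝ)..1, τ x = 1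

/-- The law of the adviser's posterior belief (probability of state `1`), with density `τ`. -/
def signalLaw (τ : ℝ → ℝ) : Measure unitInterval :=
  (volume : Measure unitInterval).withDensity fun s => ENNReal.ofReal (τ s)

/-- The prior probability of state `1`, i.e. the mean of the adviser's posterior. -/
def prior (τ : ℝ → ℝ) : ℝ := ∫ x in (0 : ℝ)..1, x * τ x

/-- The joint law of the adviser's posterior and the state, on the slice where the state is `ω`. -/
def signalStateLaw (τ : ℝ → ℝ) (ω : Fin 2) : Measure unitInterval :=
  (signalLaw τ).withDensity fun s => ENNReal.ofReal (weight s ω)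

/-- The joint law of the message and the state, on the slice where the state is `ω`, when the
adviser is truthful with probability `α` and plays `β` with probability `1 - α`. -/
def messageStateLaw (τ : ℝ → ℝ) (α : ℝ) (β : AdviserStrategy) (ω : Fin 2) : Measure unitInterval :=
  ENNReal.ofReal α • (signalStateLaw τ ω).bind truthful.1 +
    ENNReal.ofReal (1 - α) • (signalStateLaw τ ω).bind β.1

/-- The law of the message. -/
def messageLaw (τ : ℝ → ℝ) (α : ℝ) (β : AdviserStrategy) : Measure unitInterval :=
  ∑ ω, messageStateLaw τ α β ω

/-- Bayes' rule: the conditional probability of state `1` given the message. It is determined up to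
`messageLaw`-null sets of messages. -/
def posteriorBelief (τ : ℝ → ℝ) (α : ℝ) (β : AdviserStrategy) (m : unitInterval) : ℝ :=
  ((messageStateLaw τ α β 1).rnDeriv (messageLaw τ α β) m).toReal

namespace DecisionProblem

variable {A Θ : Type*} [TopologicalSpace A] [MeasurableSpace A] [MeasurableSpace Θ]

/-- The expected payoff of a private strategy conditional on the state. -/
def profile (D : DecisionProblem A Θ) (κ : PrivateStrategy A Θ) (ω : Fin 2) : ℝ :=
  ∫ θ, ∫ a, D.u a ω θ ∂(κ.1 θ) ∂(D.f ω)

/-- The expected payoff of a private strategy at the belief `μ`. -/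
def payoff (D : DecisionProblem A Θ) (κ : PrivateStrategy A Θ) (μ : ℝ) : ℝ :=
  ∑ ω, weight μ ω * D.profile κ ω

/-- `κ` is Bayes-optimal for the belief `μ`. -/
def BayesOptimal (D : DecisionProblem A Θ) (κ : PrivateStrategy A Θ) (μ : ℝ) : Prop :=
  ∀ κ' : PrivateStrategy A Θ, D.payoff κ' μ ≤ D.payoff κ μ

/-- Equality of private strategies for almost every type, in each state. -/
def SamePrivate (D : DecisionProblem A Θ) (κ κ' : PrivateStrategy A Θ) : Prop :=
  ∀ ω, ∀ᵐ θ ∂(D.f ω), κ.1 θ = κ'.1 θ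

/-- At each interior belief, the Bayes-optimal private strategy is unique (for almost every
type). -/
def UniqueBayesOptimal (D : DecisionProblem A Θ) : Prop :=
  ∀ μ ∈ Ioo (0 : ℝ) 1, ∀ κ κ' : PrivateStrategy A Θ,
    D.BayesOptimal κ μ → D.BayesOptimal κ' μ → D.SamePrivate κ κ'

/-- The indirect utility function `U`. -/
def indirect (D : DecisionProblem A Θ) (μ : ℝ) : ℝ :=
  ⨆ κ : PrivateStrategy A Θ, D.payoff κ μ

/-- `U'` on `[0, 1]`, one-sided at the end points. -/
def indirect' (D : DecisionProblem A Θ) : ℝ → ℝ :=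
  derivWithin D.indirect (Icc 0 1)

/-- `U''` on `[0, 1]`, one-sided at the end points. -/
def indirect'' (D : DecisionProblem A Θ) : ℝ → ℝ :=
  derivWithin D.indirect' (Icc 0 1)

/-- The agent's expected payoff when the adviser plays `β` and the agent plays `σ`. Given the
adviser's posterior `s` the state is `1` with probability `s`, and the agent's type depends on the
state only. -/
def expectedPayoff (D : DecisionProblem A Θ) (τ : ℝ → ℝ) (β : AdviserStrategy)
    (σ : Strategy A Θ) : ℝ :=
  ∫ s, ∫ m, D.payoff (σ.after m) s ∂(β.1 s) ∂(signalLaw τ)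

/-- The worst-case payoff of `σ` at alignment probability `α`. -/
def worstCase (D : DecisionProblem A Θ) (τ : ℝ → ℝ) (α : ℝ) (σ : Strategy A Θ) : ℝ :=
  α * D.expectedPayoff τ truthful σ + (1 - α) * ⨅ β : AdviserStrategy, D.expectedPayoff τ β σ

/-- `σ` is optimal: it attains the largest worst-case payoff. -/
def Optimal (D : DecisionProblem A Θ) (τ : ℝ → ℝ) (α : ℝ) (σ : Strategy A Θ) : Prop :=
  ∀ σ' : Strategy A Θ, D.worstCase τ α σ' ≤ D.worstCase τ α σ

/-- `β` is adversarial against `σ`: it attains the infimum in the worst-case payoff. -/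
def Adversarial (D : DecisionProblem A Θ) (τ : ℝ → ℝ) (β : AdviserStrategy)
    (σ : Strategy A Θ) : Prop :=
  ∀ β' : AdviserStrategy, D.expectedPayoff τ β σ ≤ D.expectedPayoff τ β' σ

/-- `σ` is robustly rationalizable: against some adversarial strategy `β`, it is Bayes-optimal after
almost every message, for the belief that the message induces by Bayes' rule. -/
def RobustlyRationalizable (D : DecisionProblem A Θ) (τ : ℝ → ℝ) (α : ℝ)
    (σ : Strategy A Θ) : Prop :=
  ∃ β : AdviserStrategy, D.Adversarial τ β σ ∧
    ∀ᵐ m ∂(messageLaw τ α β), D.BayesOptimal (σ.after m) (posteriorBelief τ α β m)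

/-- `σ` is a trust region strategy with trust region `T`. -/
def IsTrustRegionStrategy (D : DecisionProblem A Θ) (σ : Strategy A Θ) (T : Set unitInterval) : Prop :=
  IsCompact T ∧ ∀ m : unitInterval,
    (m ∈ T → D.BayesOptimal (σ.after m) m) ∧
    (m ∉ T → ∃ p ∈ T,
      (∀ m' ∈ T, D.payoff (σ.after m') m ≤ D.payoff (σ.after p) m) ∧
      D.BayesOptimal (σ.after m) p)

/-- The threshold `b(lo, hi)`, extended by continuity to `b(x, x) = x`. -/
def threshold (D : DecisionProblem A Θ) (lo hi : ℝ) : ℝ :=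
  if lo = hi then lo
  else (∫ x in lo..hi, x * D.indirect'' x) / (∫ x in lo..hi, D.indirect'' x)

/-- Numerator of the first balancing condition. -/
def num₁ (D : DecisionProblem A Θ) (τ : ℝ → ℝ) (α lo hi : ℝ) : ℝ :=
  α * (∫ x in (0 : ℝ)..lo, x * τ x) + (1 - α) * ∫ x in (D.threshold lo hi)..1, x * τ x

/-- Denominator of the first balancing condition. -/
def den₁ (D : DecisionProblem A Θ) (τ : ℝ → ℝ) (α lo hi : ℝ) : ℝ :=
  α * (∫ x in (0 : ℝ)..lo, τ x) + (1 - α) * ∫ x in (D.threshold lo hi)..1, τ x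

/-- Numerator of the second balancing condition. -/
def num₂ (D : DecisionProblem A Θ) (τ : ℝ → ℝ) (α lo hi : ℝ) : ℝ :=
  α * (∫ x in hi..1, x * τ x) + (1 - α) * ∫ x in (0 : ℝ)..(D.threshold lo hi), x * τ x

/-- Denominator of the second balancing condition. -/
def den₂ (D : DecisionProblem A Θ) (τ : ℝ → ℝ) (α lo hi : ℝ) : ℝ :=
  α * (∫ x in hi..1, τ x) + (1 - α) * ∫ x in (0 : ℝ)..(D.threshold lo hi), τ x

/-- The balancing conditions `num₁ / den₁ = lo` and `num₂ / den₂ = hi`, with the denominators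
cleared so that they keep their meaning at `α = 1`, where `lo = 0`, `hi = 1` and both quotients
would read `0 / 0`. -/
def Balanced (D : DecisionProblem A Θ) (τ : ℝ → ℝ) (α lo hi : ℝ) : Prop :=
  D.num₁ τ α lo hi = lo * D.den₁ τ α lo hi ∧ D.num₂ τ α lo hi = hi * D.den₂ τ α lo hi

end DecisionProblem

/-- The interval `[lo, hi]` as a set of beliefs. -/
def interval (lo hi : ℝ) : Set unitInterval := {m | (m : ℝ) ∈ Icc lo hi}

end TrustRegion

end

/-! The agent and the misaligned adviser play a zero-sum game, and the trust interval `[lo, hi]`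
comes from a saddle point of it (`optimal_of_saddle`).

The payoff of a private strategy is affine in the belief and lies below the convex function `U`.
Hence a strategy that is Bayes-optimal at an interior belief `p` pays exactly the tangent of `U` at
`p` (`Regular.payoff_eq_tangent`). An agent who acts on the message projected to `[lo, hi]`
therefore offers the adviser a menu of tangents. At each signal the worst of them is the tangent at
`lo` or at `hi`, and these two cross at the threshold `b` (`Regular.tangent_sub_tangent`). So it is
adversarial to induce `hi` at signals up to `b` and `lo` above `b`.

Conversely, these lies can be spread over messages so that every message `m` induces exactly its
projection (`exists_adviserStrategy`). A truthful message above `hi` exceeds `hi` by `m - hi`, so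
the density of lies at `m` is taken proportional to `m - hi`; similarly below `lo`. The total mass
fits precisely under the balancing conditions. If `α ≤ 1/2`, there are enough lies to make every
message induce the prior. Projection is then a best reply to these lies, which gives the saddle
point. Every other optimal strategy must also be a best reply to them, hence is Bayes-optimal for
the projection after almost every message.

For `α > 1/2`, each balancing condition is solved separately for given `b`, and the intermediate
value theorem closes the loop in `b` (`Regular.exists_zero_excess`). Uniqueness holds because a
larger `b` lowers both end points, while lower end points lower the threshold
(`Regular.unique_zero_excess`).

A trust region of an optimal strategy lies inside `[lo, hi]`, since a trusted message outside would
be exploited at signals near `b` (`Regular.mem_interval_of_adversarial`). It contains `[lo, hi]`,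
since a Bayes-optimal private strategy reveals its belief
(`Regular.interval_subset_of_isTrustRegionStrategy`). The case `α = 1`, with full trust, is separate
because tangents do not determine payoffs at the beliefs 0 and 1. -/

namespace TrustRegion

/-! ### Measurable selection of maximizers. -/

section Selection

variable {A X : Type*} [MetricSpace A] [CompactSpace A] [Nonempty A] [MeasurableSpace X]

/-- For a Carathéodory function `g` it is measurable in `x` whether the maximum of `g (π ·) x` over
the closed set `C` reaches the maximum of `g · x`. -/
theorem measurableSet_exists_max {K : Type*} [MetricSpace K] [CompactSpace K]
    {C : Set K} (hC : IsClosed C) {π : K → A} (hπ : Continuous π) {g : A → X → ℝ}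
    (hm : ∀ a, Measurable (g a)) (hc : ∀ x, Continuous fun a => g a x) :
    MeasurableSet {x | ∃ y ∈ C, ∀ a, g a x ≤ g (π y) x} := by
  obtain ⟨E, hEC, hE, hEd⟩ :=
    (TopologicalSpace.IsSeparable.of_separableSpace C).exists_countable_dense_subset
  obtain ⟨F, hF, hFd⟩ := TopologicalSpace.exists_countable_dense A
  -- The maximum is reached on `C` iff every point of a countable dense set is matched, up to every
  -- `1 / (j + 1)`, by a point of a countable dense subset of `C`. Compactness of `C` gives the
  -- converse direction.
  have key : {x | ∃ y ∈ C, ∀ a, g a x ≤ g (π y) x} =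
      ⋂ d ∈ F, ⋂ j : ℕ, ⋃ e ∈ E, {x | g d x < g (π e) x + 1 / ((j : ℝ) + 1)} := by
    ext x
    simp only [mem_ofPred_eq, mem_iInter, mem_iUnion, exists_prop]
    constructor
    · rintro ⟨y, hy, hmax⟩ d _ j
      have hpos : (0 : ℝ) < 1 / ((j : ℝ) + 1) := by positivity
      have hopen : IsOpen {z : K | g d x < g (π z) x + 1 / ((j : ℝ) + 1)} :=
        isOpen_lt continuous_const (((hc x).comp hπ).add continuous_const)
      obtain ⟨e, he, heE⟩ := mem_closure_iff.1 (hEd hy) _ hopen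
        (show g d x < g (π y) x + 1 / ((j : ℝ) + 1) by linarith [hmax d])
      exact ⟨e, heE, he⟩
    · intro h
      obtain ⟨d₀, hd₀⟩ := hFd.nonempty
      obtain ⟨e₀, he₀, -⟩ := h d₀ hd₀ 0
      obtain ⟨y, hy, hmax⟩ := hC.isCompact.exists_isMaxOn ⟨e₀, hEC he₀⟩
        ((hc x).comp hπ).continuousOn
      refine ⟨y, hy, fun a => ?_⟩
      have hcl : IsClosed {a | g a x ≤ g (π y) x} := isClosed_le (hc x) continuous_const
      refine hcl.closure_subset_iff.2 (fun d hd => ?_) (hFd a)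
      refine le_of_forall_pos_le_add (α := ℝ) fun ε hε => ?_
      obtain ⟨j, hj⟩ := exists_nat_one_div_lt hε
      obtain ⟨e, he, hlt⟩ := h d hd j
      have : g (π e) x ≤ g (π y) x := hmax (hEC he)
      linarith
  rw [key]
  refine MeasurableSet.biInter hF fun d _ => MeasurableSet.iInter fun j =>
    MeasurableSet.biUnion hE fun e _ => ?_
  exact measurableSet_lt (hm d) ((hm _).add measurable_const)

/-- Measurable maximum theorem: a Carathéodory function on a compact metric space has a measurable
selection of maximizers. -/
theorem exists_measurable_argmax [MeasurableSpace A] [BorelSpace A] (g : A → X → ℝ)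
    (hm : ∀ a, Measurable (g a)) (hc : ∀ x, Continuous fun a => g a x) :
    ∃ φ : X → A, Measurable φ ∧ ∀ x a, g a x ≤ g (φ x) x := by
  -- Coding actions by points of the Cantor set orders them inside `ℝ`. The least code of a
  -- maximizer is a canonical choice, and its sublevel sets are those of `measurableSet_exists_max`.
  obtain ⟨f, hf, hfs⟩ := exists_nat_bool_continuous_surjective_of_compact A
  set π : cantorSet → A := f ∘ cantorSetHomeomorphNatToBool with hπ_def
  have hπ : Continuous π := hf.comp cantorSetHomeomorphNatToBool.continuous
  have hπs : Function.Surjective π := hfs.comp cantorSetHomeomorphNatToBool.surjective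
  have : CompactSpace cantorSet := isCompact_iff_compactSpace.1 isCompact_cantorSet
  let M : X → Set cantorSet := fun x => {y | ∀ a, g a x ≤ g (π y) x}
  have hMc : ∀ x, IsClosed (M x) := fun x => by
    have : M x = ⋂ a, {y | g a x ≤ g (π y) x} := by ext y; simp [M]
    rw [this]
    exact isClosed_iInter fun a => isClosed_le continuous_const ((hc x).comp hπ)
  have hMne : ∀ x, (M x).Nonempty := fun x => by
    obtain ⟨a, ha⟩ := (hc x).exists_forall_ge_of_hasCompactMulSupport
      (HasCompactMulSupport.of_compactSpace _)
    obtain ⟨y, rfl⟩ := hπs a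
    exact ⟨y, ha⟩
  have hmin : ∀ x, ∃ y ∈ M x, ∀ z ∈ M x, (y : ℝ) ≤ z := fun x =>
    ((hMc x).isCompact.exists_isMinOn (hMne x) continuous_subtype_val.continuousOn)
  choose t htM htmin using hmin
  have hmeas : Measurable t := by
    refine Measurable.subtype_mk (f := fun x => (t x : ℝ)) (h := fun x => (t x).2) ?_
    refine measurable_of_Iic fun c => ?_
    have : (fun x => (t x : ℝ)) ⁻¹' Iic c =
        {x | ∃ y ∈ {y : cantorSet | (y : ℝ) ≤ c}, ∀ a, g a x ≤ g (π y) x} := by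
      ext x
      exact ⟨fun h => ⟨t x, h, htM x⟩, fun ⟨y, hy, hyM⟩ => (htmin x y hyM).trans hy⟩
    rw [this]
    exact measurableSet_exists_max (isClosed_le continuous_subtype_val continuous_const) hπ hm hc
  exact ⟨π ∘ t, hπ.measurable.comp hmeas, fun x => htM x⟩

end Selection

/-! ### Payoffs of private strategies: bounds and measurability. -/

theorem weight_zero (μ : ℝ) : weight μ 0 = 1 - μ := rfl

theorem weight_one (μ : ℝ) : weight μ 1 = μ := rfl

theorem weight_nonneg {μ : ℝ} (h0 : 0 ≤ μ) (h1 : μ ≤ 1) (ω : Fin 2) : 0 ≤ weight μ ω := by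
  fin_cases ω
  · exact sub_nonneg.2 h1
  · exact h0

theorem continuous_weight (ω : Fin 2) : Continuous fun μ => weight μ ω := by
  fin_cases ω
  · exact continuous_const.sub continuous_id
  · exact continuous_id

namespace DecisionProblem

section Measurability

variable {A Θ : Type*} [TopologicalSpace A] [MeasurableSpace A] [MeasurableSpace Θ]
  (D : DecisionProblem A Θ)

theorem payoff_eq (κ : PrivateStrategy A Θ) (μ : ℝ) :
    D.payoff κ μ = (1 - μ) * D.profile κ 0 + μ * D.profile κ 1 := by
  simp [payoff, Fin.sum_univ_two, weight_zero, weight_one]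

theorem exists_bound_profile : ∃ C : ℝ, ∀ κ ω, |D.profile κ ω| ≤ C := by
  obtain ⟨C, hC⟩ := D.bounded_u
  refine ⟨C, fun κ ω => ?_⟩
  have := D.isProb ω
  have := κ.2
  have hin : ∀ θ, ‖∫ a, D.u a ω θ ∂(κ.1 θ)‖ ≤ C := fun θ => by
    simpa using norm_integral_le_of_norm_le_const (μ := κ.1 θ) (f := fun a => D.u a ω θ) (C := C)
      (.of_forall fun a => hC a ω θ)
  simpa [profile] using
    norm_integral_le_of_norm_le_const (μ := D.f ω) (.of_forall hin)

theorem exists_bound_payoff : ∃ C : ℝ, ∀ κ, ∀ μ ∈ Icc (0 : ℝ) 1, |D.payoff κ μ| ≤ C := by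
  obtain ⟨C, hC⟩ := D.exists_bound_profile
  refine ⟨C, fun κ μ hμ => ?_⟩
  rw [payoff_eq]
  have h0 := abs_le.1 (hC κ 0)
  have h1 := abs_le.1 (hC κ 1)
  rw [abs_le]
  constructor <;> nlinarith [hμ.1, hμ.2]

theorem measurable_profile_after (σ : Strategy A Θ) (ω : Fin 2) :
    Measurable fun m => D.profile (σ.after m) ω := by
  have := D.isProb ω
  have := σ.2
  have h1 : StronglyMeasurable fun p : unitInterval × Θ => ∫ a, D.u a ω p.2 ∂(σ.1 p) := by
    refine StronglyMeasurable.integral_kernel_prod_right (κ := σ.1)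
      (f := fun (p : unitInterval × Θ) a => D.u a ω p.2) ?_
    exact ((D.measurable_u ω).comp
      (measurable_snd.prodMk (measurable_snd.comp measurable_fst))).stronglyMeasurable
  exact (h1.integral_prod_right' (ν := D.f ω)).measurable

theorem measurable_inner (κ : PrivateStrategy A Θ) (ω : Fin 2) :
    Measurable fun θ => ∫ a, D.u a ω θ ∂(κ.1 θ) := by
  have := κ.2
  refine (StronglyMeasurable.integral_kernel_prod_right (κ := κ.1)
      (f := fun (θ : Θ) a => D.u a ω θ) ?_).measurable
  exact ((D.measurable_u ω).comp measurable_swap).stronglyMeasurable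

end Measurability

/-! ### Existence of Bayes-optimal strategies, measurably in the message. -/

section Existence

variable {A Θ : Type*} [MetricSpace A] [CompactSpace A] [Nonempty A] [MeasurableSpace A]
  [BorelSpace A] [MeasurableSpace Θ] (D : DecisionProblem A Θ)

/-- There is a strategy that, after each message, is Bayes-optimal for the message. -/
theorem exists_bayesOptimal_strategy :
    ∃ σ : Strategy A Θ, ∀ m, D.BayesOptimal (σ.after m) m := by
  have hP := D.isProb
  obtain ⟨C, hC⟩ := D.bounded_u
  -- Both type laws have densities `r` with respect to their sum `ν`. The payoff becomes a single
  -- integral against `ν`, which is maximized by maximizing `g` at each message and type.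
  set ν : Measure Θ := D.f 0 + D.f 1 with hν
  have hac : ∀ ω, D.f ω ≪ ν := by
    intro ω
    fin_cases ω
    · exact Measure.AbsolutelyContinuous.rfl.add_right _
    · rw [hν, add_comm]
      exact Measure.AbsolutelyContinuous.rfl.add_right _
  set r : Fin 2 → Θ → ℝ := fun ω θ => ((D.f ω).rnDeriv ν θ).toReal with hr
  have hrm : ∀ ω, Measurable (r ω) := fun ω => (Measure.measurable_rnDeriv _ _).ennreal_toReal
  let g : A → unitInterval × Θ → ℝ := fun a p =>
    ∑ ω, weight p.1 ω * (r ω p.2 * D.u a ω p.2)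
  obtain ⟨φ, hφm, hφ⟩ := exists_measurable_argmax g
    (fun a => Finset.measurable_sum _ fun ω _ =>
      ((((continuous_weight ω).comp continuous_subtype_val).measurable.comp measurable_fst)).mul
        (((hrm ω).comp measurable_snd).mul
          ((D.measurable_u ω).comp (measurable_const.prodMk measurable_snd))))
    (fun p => continuous_finsetSum _ fun ω _ =>
      continuous_const.mul (continuous_const.mul (D.continuous_u ω p.2)))
  have hin : ∀ (κ : PrivateStrategy A Θ) ω,
      Integrable (fun θ => r ω θ * ∫ a, D.u a ω θ ∂(κ.1 θ)) ν := fun κ ω => by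
    have := κ.2
    refine (integrable_rnDeriv_smul_iff (hac ω)).2 ?_
    refine Integrable.of_bound (D.measurable_inner κ ω).aestronglyMeasurable C
      (.of_forall fun θ => ?_)
    simpa using norm_integral_le_of_norm_le_const (μ := κ.1 θ) (f := fun a => D.u a ω θ) (C := C)
      (.of_forall fun a => hC a ω θ)
  have hiu : ∀ (κ : PrivateStrategy A Θ) ω θ, Integrable (fun a => D.u a ω θ) (κ.1 θ) :=
    fun κ ω θ => by
      have := κ.2
      exact Integrable.of_bound (D.continuous_u ω θ).measurable.aestronglyMeasurable C
        (.of_forall fun a => hC a ω θ)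
  have hig : ∀ (κ : PrivateStrategy A Θ) (m : unitInterval) θ,
      ∫ a, g a (m, θ) ∂(κ.1 θ) = ∑ ω, weight m ω * (r ω θ * ∫ a, D.u a ω θ ∂(κ.1 θ)) := by
    intro κ m θ
    simp only [g]
    rw [integral_finsetSum _ fun ω _ => ((hiu κ ω θ).const_mul _).const_mul _]
    simp only [integral_const_mul]
  have hpay : ∀ (κ : PrivateStrategy A Θ) (m : unitInterval),
      Integrable (fun θ => ∫ a, g a (m, θ) ∂(κ.1 θ)) ν ∧
      D.payoff κ m = ∫ θ, ∫ a, g a (m, θ) ∂(κ.1 θ) ∂ν := by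
    intro κ m
    simp only [hig]
    refine ⟨integrable_finsetSum _ fun ω _ => (hin κ ω).const_mul _, ?_⟩
    rw [integral_finsetSum _ fun ω _ => (hin κ ω).const_mul _]
    refine Finset.sum_congr rfl fun ω _ => ?_
    rw [integral_const_mul, profile]
    congr 1
    exact (integral_rnDeriv_smul (hac ω)).symm
  refine ⟨⟨Kernel.deterministic φ hφm, inferInstance⟩, fun m κ => ?_⟩
  have hσ := hpay (Strategy.after ⟨Kernel.deterministic φ hφm, inferInstance⟩ m) m
  rw [(hpay κ m).2, hσ.2]
  refine integral_mono (hpay κ m).1 hσ.1 fun θ => ?_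
  have hgi : Integrable (fun a => g a (m, θ)) (κ.1 θ) :=
    integrable_finsetSum _ fun ω _ => ((hiu κ ω θ).const_mul _).const_mul _
  have := κ.2
  calc ∫ a, g a (m, θ) ∂(κ.1 θ) ≤ ∫ _, g (φ (m, θ)) (m, θ) ∂(κ.1 θ) :=
        integral_mono hgi (integrable_const _) fun a => hφ (m, θ) a
    _ = g (φ (m, θ)) (m, θ) := by simp
    _ = _ := by simp [Strategy.after, Kernel.deterministic_apply]

end Existence

/-! ### Bayes-optimal payoffs as tangents of the indirect utility. -/

section Convexity

variable {A Θ : Type*} [TopologicalSpace A] [MeasurableSpace A] [MeasurableSpace Θ]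

/-- The indirect utility is strictly convex and twice differentiable on `[0, 1]`. -/
structure Regular (D : DecisionProblem A Θ) : Prop where
  convex : StrictConvexOn ℝ (Icc 0 1) D.indirect
  diff : DifferentiableOn ℝ D.indirect (Icc 0 1)
  diff' : DifferentiableOn ℝ D.indirect' (Icc 0 1)

/-- The tangent of the indirect utility at `p`. -/
noncomputable def tangent (D : DecisionProblem A Θ) (p x : ℝ) : ℝ :=
  D.indirect p + D.indirect' p * (x - p)

variable {D : DecisionProblem A Θ} {κ κ' : PrivateStrategy A Θ} {p q x y : ℝ}

theorem tangent_self : D.tangent p p = D.indirect p := by simp [tangent]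

theorem payoff_le_indirect (hx : x ∈ Icc (0 : ℝ) 1) : D.payoff κ x ≤ D.indirect x := by
  obtain ⟨C, hC⟩ := D.exists_bound_payoff
  refine le_ciSup (f := fun κ => D.payoff κ x) ⟨C, ?_⟩ κ
  rintro _ ⟨κ', rfl⟩
  exact (le_abs_self _).trans (hC κ' x hx)

theorem bayesOptimal_iff (hx : x ∈ Icc (0 : ℝ) 1) :
    D.BayesOptimal κ x ↔ D.payoff κ x = D.indirect x := by
  constructor
  · intro h
    have : Nonempty (PrivateStrategy A Θ) := ⟨κ⟩
    exact le_antisymm (payoff_le_indirect hx) (ciSup_le h)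
  · intro h κ'
    rw [h]
    exact payoff_le_indirect hx

theorem Regular.tangent_lt (h : D.Regular) (hp : p ∈ Icc (0 : ℝ) 1) (hx : x ∈ Icc (0 : ℝ) 1)
    (hpx : p ≠ x) : D.tangent p x < D.indirect x := by
  rcases lt_or_gt_of_ne hpx with hlt | hlt
  · have := h.convex.derivWithin_lt_slope hp hx hlt (h.diff p hp)
    rw [slope_def_field, lt_div_iff₀ (sub_pos.2 hlt)] at this
    rw [tangent, indirect']
    linarith
  · have := h.convex.slope_lt_derivWithin hx hp hlt (h.diff p hp)
    rw [slope_def_field, div_lt_iff₀ (sub_pos.2 hlt)] at this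
    rw [tangent, indirect']
    linarith

theorem Regular.tangent_le (h : D.Regular) (hp : p ∈ Icc (0 : ℝ) 1) (hx : x ∈ Icc (0 : ℝ) 1) :
    D.tangent p x ≤ D.indirect x := by
  rcases eq_or_ne p x with rfl | hpx
  · exact tangent_self.le
  · exact (h.tangent_lt hp hx hpx).le

theorem Regular.strictMonoOn_indirect' (h : D.Regular) :
    StrictMonoOn D.indirect' (Icc 0 1) :=
  h.convex.strictMonoOn_derivWithin h.diff

theorem payoff_sub (κ : PrivateStrategy A Θ) (x y : ℝ) :
    D.payoff κ x = D.payoff κ y + (D.profile κ 1 - D.profile κ 0) * (x - y) := by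
  simp only [payoff_eq]; ring

/-- The payoff is affine and touches `U` from below at `p`, so the slopes agree. At an end point of
`[0, 1]` one-sided contact would not fix the slope. -/
theorem Regular.payoff_eq_tangent (h : D.Regular) (hp : p ∈ Ioo (0 : ℝ) 1)
    (hκ : D.BayesOptimal κ p) (x : ℝ) : D.payoff κ x = D.tangent p x := by
  have hpI := Ioo_subset_Icc_self hp
  have hmem : Icc (0 : ℝ) 1 ∈ nhds p := Icc_mem_nhds hp.1 hp.2
  have hU : HasDerivAt D.indirect (D.indirect' p) p :=
    (h.diff p hpI).hasDerivWithinAt.hasDerivAt hmem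
  have hκ' := (bayesOptimal_iff hpI).1 hκ
  have hP : HasDerivAt (fun y => D.payoff κ y) (D.profile κ 1 - D.profile κ 0) p := by
    have : (fun y => D.payoff κ y) =
        fun y => D.payoff κ p + (D.profile κ 1 - D.profile κ 0) * (y - p) :=
      funext fun y => payoff_sub κ y p
    rw [this]
    simpa using (((hasDerivAt_id p).sub_const p).const_mul
      (D.profile κ 1 - D.profile κ 0)).const_add (D.payoff κ p)
  have hmin : IsLocalMin (fun y => D.indirect y - D.payoff κ y) p := by
    filter_upwards [hmem] with y hy
    simp only [hκ', sub_self]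
    exact sub_nonneg.2 (payoff_le_indirect hy)
  have h0 := hmin.hasDerivAt_eq_zero (hU.sub hP)
  rw [payoff_sub κ x p, hκ', tangent, sub_eq_zero.1 h0]

theorem profile_eq_of_payoff_eq (h : ∀ x, D.payoff κ x = D.payoff κ' x) :
    D.profile κ = D.profile κ' := by
  have h0 := h 0
  have h1 := h 1
  simp only [payoff_eq] at h0 h1
  funext ω
  fin_cases ω
  · simpa using h0
  · simpa using h1

/-- An affine function that meets the strictly convex `U` at two points would exceed it halfway
between them. -/
theorem Regular.eq_of_bayesOptimal (h : D.Regular) (hp : p ∈ Icc (0 : ℝ) 1)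
    (hq : q ∈ Icc (0 : ℝ) 1) (hκp : D.BayesOptimal κ p) (hκq : D.BayesOptimal κ q) : p = q := by
  by_contra hne
  have hlt := h.convex.2 hp hq hne (by norm_num : (0 : ℝ) < 1 / 2)
    (by norm_num : (0 : ℝ) < 1 / 2) (by norm_num)
  have hle : D.payoff κ ((1 / 2 : ℝ) • p + (1 / 2 : ℝ) • q) ≤ _ :=
    payoff_le_indirect (h.convex.1 hp hq (by norm_num : (0 : ℝ) ≤ 1 / 2)
      (by norm_num : (0 : ℝ) ≤ 1 / 2) (by norm_num))
  rw [← (bayesOptimal_iff hp).1 hκp, ← (bayesOptimal_iff hq).1 hκq] at hlt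
  simp only [payoff_eq, smul_eq_mul] at hlt hle
  linarith

/-- Single crossing: optimality at `p` and at `q` forces the payoff line for the higher belief to be
at least as steep. No derivative is involved, so this also covers the beliefs 0 and 1. -/
theorem payoff_le_payoff_of_lt_of_le (hpq : p < q) (hqx : q ≤ x)
    (hκp : D.BayesOptimal κ p) (hκq : D.BayesOptimal κ' q) : D.payoff κ x ≤ D.payoff κ' x := by
  have h1 := hκp κ'
  have h2 := hκq κ
  have e1 := payoff_sub (D := D) κ q p
  have e2 := payoff_sub (D := D) κ' q p
  have e3 := payoff_sub (D := D) κ x q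
  have e4 := payoff_sub (D := D) κ' x q
  set k := D.profile κ 1 - D.profile κ 0
  set k' := D.profile κ' 1 - D.profile κ' 0
  have hk : k ≤ k' := by
    by_contra! hlt
    nlinarith
  nlinarith

theorem payoff_le_payoff_of_lt_of_ge (hpq : q < p) (hqx : x ≤ q)
    (hκp : D.BayesOptimal κ p) (hκq : D.BayesOptimal κ' q) : D.payoff κ x ≤ D.payoff κ' x := by
  have h1 := hκp κ'
  have h2 := hκq κ
  have e1 := payoff_sub (D := D) κ q p
  have e2 := payoff_sub (D := D) κ' q p
  have e3 := payoff_sub (D := D) κ x q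
  have e4 := payoff_sub (D := D) κ' x q
  set k := D.profile κ 1 - D.profile κ 0
  set k' := D.profile κ' 1 - D.profile κ' 0
  have hk : k' ≤ k := by
    by_contra! hlt
    nlinarith
  nlinarith

/-- Tangents at points closer to `x` are higher at `x`. -/
theorem Regular.tangent_le_tangent_left (h : D.Regular) (hp : p ∈ Icc (0 : ℝ) 1)
    (hq : q ∈ Icc (0 : ℝ) 1) (hpq : p ≤ q) (hqx : q ≤ x) : D.tangent p x ≤ D.tangent q x := by
  have h1 := h.tangent_le hp hq
  have h2 := h.strictMonoOn_indirect'.monotoneOn hp hq hpq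
  simp only [tangent] at *
  nlinarith

theorem Regular.tangent_le_tangent_right (h : D.Regular) (hp : p ∈ Icc (0 : ℝ) 1)
    (hq : q ∈ Icc (0 : ℝ) 1) (hpq : q ≤ p) (hqx : x ≤ q) : D.tangent p x ≤ D.tangent q x := by
  have h1 := h.tangent_le hp hq
  have h2 := h.strictMonoOn_indirect'.monotoneOn hq hp hpq
  simp only [tangent] at *
  nlinarith

/-! ### The threshold as the crossing point of two tangents. -/

section Threshold

variable {lo hi lo' hi' : ℝ}

theorem threshold_self : D.threshold x x = x := by simp [threshold]

/-- `x * U'' x` has the antiderivative `x * U' x - U x`, which removes the integrals from the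
threshold. -/
theorem Regular.threshold_eq (h : D.Regular) (h0 : 0 ≤ lo) (hlt : lo < hi) (h1 : hi ≤ 1) :
    D.threshold lo hi =
      (hi * D.indirect' hi - D.indirect hi - (lo * D.indirect' lo - D.indirect lo)) /
        (D.indirect' hi - D.indirect' lo) := by
  have hsub : Icc lo hi ⊆ Icc (0 : ℝ) 1 := Icc_subset_Icc h0 h1
  have hnh : ∀ x ∈ Ioo lo hi, Icc (0 : ℝ) 1 ∈ nhds x := fun x hx =>
    Icc_mem_nhds (h0.trans_lt hx.1) (hx.2.trans_le h1)
  have hd : ∀ x ∈ Ioo lo hi, HasDerivAt D.indirect (D.indirect' x) x := fun x hx =>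
    (h.diff x (hsub (Ioo_subset_Icc_self hx))).hasDerivWithinAt.hasDerivAt (hnh x hx)
  have hd' : ∀ x ∈ Ioo lo hi, HasDerivAt D.indirect' (D.indirect'' x) x := fun x hx =>
    (h.diff' x (hsub (Ioo_subset_Icc_self hx))).hasDerivWithinAt.hasDerivAt (hnh x hx)
  have hc := h.diff.continuousOn.mono hsub
  have hc' := h.diff'.continuousOn.mono hsub
  have hpos : ∀ x, 0 ≤ D.indirect'' x := fun x =>
    h.strictMonoOn_indirect'.monotoneOn.derivWithin_nonneg
  -- `U''` need not be continuous; as the nonnegative derivative of a continuous function it is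
  -- integrable.
  have hint : IntervalIntegrable D.indirect'' volume lo hi := by
    refine intervalIntegral.intervalIntegrable_deriv_of_nonneg (g := D.indirect') ?_ ?_
      fun x _ => hpos x
    · rwa [uIcc_of_le hlt.le]
    · rwa [min_eq_left hlt.le, max_eq_right hlt.le]
  have e1 : ∫ x in lo..hi, D.indirect'' x = D.indirect' hi - D.indirect' lo :=
    intervalIntegral.integral_eq_sub_of_hasDerivAt_of_le hlt.le hc' hd' hint
  have e2 : ∫ x in lo..hi, x * D.indirect'' x =
      (hi * D.indirect' hi - D.indirect hi) - (lo * D.indirect' lo - D.indirect lo) := by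
    refine intervalIntegral.integral_eq_sub_of_hasDerivAt_of_le
      (f := fun x => x * D.indirect' x - D.indirect x) hlt.le
      ((continuousOn_id.mul hc').sub hc) (fun x hx => ?_)
      (hint.continuousOn_mul continuousOn_id)
    have := ((hasDerivAt_id x).mul (hd' x hx)).sub (hd x hx)
    exact this.congr_deriv (by simp)
  rw [threshold, if_neg hlt.ne, e1, e2]

/-- This locates the threshold where the tangents at `lo` and `hi` cross, with the sign of their
difference on either side. -/
theorem Regular.tangent_sub_tangent (h : D.Regular) (h0 : 0 ≤ lo) (hle : lo ≤ hi) (h1 : hi ≤ 1)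
    (x : ℝ) : D.tangent hi x - D.tangent lo x =
      (D.indirect' hi - D.indirect' lo) * (x - D.threshold lo hi) := by
  rcases hle.eq_or_lt with rfl | hlt
  · simp
  · have hpos : 0 < D.indirect' hi - D.indirect' lo :=
      sub_pos.2 (h.strictMonoOn_indirect' ⟨h0, hle.trans h1⟩ ⟨h0.trans hle, h1⟩ hlt)
    rw [h.threshold_eq h0 hlt h1, mul_sub, mul_div_cancel₀ _ hpos.ne']
    simp only [tangent]
    ring

theorem Regular.threshold_mem_Ioo (h : D.Regular) (h0 : 0 ≤ lo) (hlt : lo < hi) (h1 : hi ≤ 1) :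
    D.threshold lo hi ∈ Ioo lo hi := by
  have hl : lo ∈ Icc (0 : ℝ) 1 := ⟨h0, hlt.le.trans h1⟩
  have hh : hi ∈ Icc (0 : ℝ) 1 := ⟨h0.trans hlt.le, h1⟩
  have hpos : 0 < D.indirect' hi - D.indirect' lo := sub_pos.2 (h.strictMonoOn_indirect' hl hh hlt)
  have e1 := h.tangent_sub_tangent h0 hlt.le h1 lo
  have e2 := h.tangent_sub_tangent h0 hlt.le h1 hi
  rw [tangent_self] at e1 e2
  constructor
  · have := h.tangent_lt hh hl hlt.ne'
    by_contra! hle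
    nlinarith
  · have := h.tangent_lt hl hh hlt.ne
    by_contra! hle
    nlinarith

theorem Regular.threshold_mem_Icc (h : D.Regular) (h0 : 0 ≤ lo) (hle : lo ≤ hi) (h1 : hi ≤ 1) :
    D.threshold lo hi ∈ Icc lo hi := by
  rcases hle.eq_or_lt with rfl | hlt
  · simp [threshold_self]
  · exact Ioo_subset_Icc_self (h.threshold_mem_Ioo h0 hlt h1)

theorem Regular.tangent_threshold (h : D.Regular) (h0 : 0 ≤ lo) (hle : lo ≤ hi) (h1 : hi ≤ 1) :
    D.tangent hi (D.threshold lo hi) = D.tangent lo (D.threshold lo hi) := by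
  have := h.tangent_sub_tangent h0 hle h1 (D.threshold lo hi)
  rw [sub_self, mul_zero, sub_eq_zero] at this
  exact this

theorem Regular.tangent_hi_le (h : D.Regular) (h0 : 0 ≤ lo) (hle : lo ≤ hi) (h1 : hi ≤ 1)
    (hx : x ≤ D.threshold lo hi) : D.tangent hi x ≤ D.tangent lo x := by
  have := h.tangent_sub_tangent h0 hle h1 x
  have hm := h.strictMonoOn_indirect'.monotoneOn ⟨h0, hle.trans h1⟩ ⟨h0.trans hle, h1⟩ hle
  nlinarith

theorem Regular.tangent_lo_le (h : D.Regular) (h0 : 0 ≤ lo) (hle : lo ≤ hi) (h1 : hi ≤ 1)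
    (hx : D.threshold lo hi ≤ x) : D.tangent lo x ≤ D.tangent hi x := by
  have := h.tangent_sub_tangent h0 hle h1 x
  have hm := h.strictMonoOn_indirect'.monotoneOn ⟨h0, hle.trans h1⟩ ⟨h0.trans hle, h1⟩ hle
  nlinarith

/-- If the crossing point `b'` of the lower pair lay beyond that of the upper pair, the tangent at
`hi` would be strictly above that at `lo` there. But at `b'` tangents at closer points are higher,
so the tangent at `hi` is at most that at `hi'`, which equals that at `lo'`, which is at most that
at `lo`. -/
theorem Regular.threshold_mono (h : D.Regular) (h0 : 0 ≤ lo') (hlo : lo' ≤ lo) (hle : lo ≤ hi)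
    (hle' : lo' ≤ hi') (hhi : hi' ≤ hi) (h1 : hi ≤ 1) :
    D.threshold lo' hi' ≤ D.threshold lo hi := by
  have hb := h.threshold_mem_Icc (h0.trans hlo) hle h1
  have hb' := h.threshold_mem_Icc h0 hle' (hhi.trans h1)
  by_contra! hlt
  have hlohi : lo < hi := hb.1.trans_lt (hlt.trans_le (hb'.2.trans hhi))
  have hlo1 : lo ∈ Icc (0 : ℝ) 1 := ⟨h0.trans hlo, hle.trans h1⟩
  have hhi1 : hi ∈ Icc (0 : ℝ) 1 := ⟨hlo1.1.trans hle, h1⟩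
  have hpos := sub_pos.2 (h.strictMonoOn_indirect' hlo1 hhi1 hlohi)
  have e := h.tangent_sub_tangent hlo1.1 hle h1 (D.threshold lo' hi')
  have e' := h.tangent_threshold h0 hle' (hhi.trans h1)
  have i1 := h.tangent_le_tangent_right hhi1 ⟨h0.trans hle', hhi.trans h1⟩ hhi hb'.2
  have i2 := h.tangent_le_tangent_left ⟨h0, hlo.trans hlo1.2⟩ hlo1 hlo (hb.1.trans hlt.le)
  nlinarith [mul_pos hpos (sub_pos.2 hlt)]

/-- A private strategy that is Bayes-optimal for a belief outside `[lo, hi]` does worse at the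
threshold than the tangents at `lo` and `hi`. -/
theorem Regular.payoff_threshold_lt (h : D.Regular) (h0 : 0 ≤ lo) (hle : lo ≤ hi) (h1 : hi ≤ 1)
    (hp : p ∈ Icc (0 : ℝ) 1) (hpT : p ∉ Icc lo hi) (hκ : D.BayesOptimal κ p) :
    D.payoff κ (D.threshold lo hi) < D.tangent hi (D.threshold lo hi) := by
  have hb := h.threshold_mem_Icc h0 hle h1
  set b := D.threshold lo hi with hb_def
  have hlo1 : lo ∈ Icc (0 : ℝ) 1 := ⟨h0, hle.trans h1⟩
  have hhi1 : hi ∈ Icc (0 : ℝ) 1 := ⟨h0.trans hle, h1⟩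
  have strict : ∀ q ∈ Icc (0 : ℝ) 1, p ≠ q → D.payoff κ q < D.indirect q := fun q hq hpq =>
    lt_of_le_of_ne (payoff_le_indirect hq) fun he =>
      hpq (h.eq_of_bayesOptimal hp hq hκ ((bayesOptimal_iff hq).2 he))
  have hκp := (bayesOptimal_iff hp).1 hκ
  rw [mem_Icc, not_and_or, not_le, not_le] at hpT
  rcases hpT with hpT | hpT
  -- At `p < lo` the payoff is at least the tangent at `lo`, yet at `lo` it is strictly lower. So
  -- its slope is smaller than that of the tangent, and it stays strictly below from `lo` on.
  · rw [hb_def, h.tangent_threshold h0 hle h1, ← hb_def]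
    have s := strict lo hlo1 hpT.ne
    have t := h.tangent_le hlo1 hp
    rw [← hκp] at t
    rw [payoff_sub κ p lo] at t
    rw [payoff_sub κ b lo]
    simp only [tangent] at *
    have : D.profile κ 1 - D.profile κ 0 < D.indirect' lo := by
      by_contra! hk
      nlinarith
    nlinarith [hb.1]
  · have s := strict hi hhi1 hpT.ne'
    have t := h.tangent_le hhi1 hp
    rw [← hκp] at t
    rw [payoff_sub κ p hi] at t
    rw [payoff_sub κ b hi]
    simp only [tangent] at *
    have : D.indirect' hi < D.profile κ 1 - D.profile κ 0 := by
      by_contra! hk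
      nlinarith
    nlinarith [hb.2]

end Threshold

end Convexity

end DecisionProblem
-- The balancing conditions: existence and uniqueness of solutions.
/-- The zero of a family of strictly increasing functions depends continuously on the parameter. -/
theorem continuousOn_of_strictMonoOn_zero {φ : ℝ → ℝ → ℝ} {L : ℝ → ℝ} {S : Set ℝ} {a c : ℝ}
    (hφ : ∀ l ∈ Icc a c, ContinuousOn (φ l) S)
    (hmono : ∀ b ∈ S, StrictMonoOn (fun l => φ l b) (Icc a c))
    (hL : ∀ b ∈ S, L b ∈ Icc a c) (hzero : ∀ b ∈ S, φ (L b) b = 0) : ContinuousOn L S := by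
  intro b₀ hb₀
  refine tendsto_order.2 ⟨fun l hl => ?_, fun l hl => ?_⟩
  · rcases lt_or_ge l a with hla | hla
    · filter_upwards [self_mem_nhdsWithin] with b hb
      exact hla.trans_le (hL b hb).1
    · have hlT : l ∈ Icc a c := ⟨hla, hl.le.trans (hL b₀ hb₀).2⟩
      have hneg : φ l b₀ < 0 := hzero b₀ hb₀ ▸ hmono b₀ hb₀ hlT (hL b₀ hb₀) hl
      filter_upwards [self_mem_nhdsWithin, (hφ l hlT b₀ hb₀).eventually (gt_mem_nhds hneg)]
        with b hb hlt
      exact ((hmono b hb).lt_iff_lt hlT (hL b hb)).1 (hlt.trans_eq (hzero b hb).symm)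
  · rcases lt_or_ge c l with hla | hla
    · filter_upwards [self_mem_nhdsWithin] with b hb
      exact (hL b hb).2.trans_lt hla
    · have hlT : l ∈ Icc a c := ⟨(hL b₀ hb₀).1.trans hl.le, hla⟩
      have hpos : 0 < φ l b₀ := hzero b₀ hb₀ ▸ hmono b₀ hb₀ (hL b₀ hb₀) hlT hl
      filter_upwards [self_mem_nhdsWithin, (hφ l hlT b₀ hb₀).eventually (lt_mem_nhds hpos)]
        with b hb hlt
      exact ((hmono b hb).lt_iff_lt (hL b hb) hlT).1 ((hzero b hb).trans_lt hlt)

/-- `F` and `M` behave like the distribution function and the partial mean of a law on `[0, 1]`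
with full support, no atoms and mean `μ₀`. -/
structure IsPartialMoments (F M : ℝ → ℝ) (μ₀ : ℝ) : Prop where
  contF : ContinuousOn F (Icc 0 1)
  contM : ContinuousOn M (Icc 0 1)
  F_zero : F 0 = 0
  M_zero : M 0 = 0
  F_one : F 1 = 1
  M_one : M 1 = μ₀
  lt_left : ∀ a c, 0 ≤ a → a < c → c ≤ 1 → a * (F c - F a) < M c - M a
  lt_right : ∀ a c, 0 ≤ a → a < c → c ≤ 1 → M c - M a < c * (F c - F a)

/-- The excess in the lower balancing condition. -/
def lowerExcess (F M : ℝ → ℝ) (μ₀ α l b : ℝ) : ℝ :=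
  l * (α * F l + (1 - α) * (1 - F b)) - (α * M l + (1 - α) * (μ₀ - M b))

/-- The excess in the upper balancing condition. -/
def upperExcess (F M : ℝ → ℝ) (μ₀ α h b : ℝ) : ℝ :=
  h * (α * (1 - F h) + (1 - α) * F b) - (α * (μ₀ - M h) + (1 - α) * M b)

namespace IsPartialMoments

variable {F M : ℝ → ℝ} {μ₀ α : ℝ}

theorem le_left (h : IsPartialMoments F M μ₀) {a c : ℝ} (ha : 0 ≤ a) (hac : a ≤ c) (hc : c ≤ 1) :
    a * (F c - F a) ≤ M c - M a := by
  rcases hac.eq_or_lt with rfl | hlt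
  · simp
  · exact (h.lt_left a c ha hlt hc).le

theorem le_right (h : IsPartialMoments F M μ₀) {a c : ℝ} (ha : 0 ≤ a) (hac : a ≤ c) (hc : c ≤ 1) :
    M c - M a ≤ c * (F c - F a) := by
  rcases hac.eq_or_lt with rfl | hlt
  · simp
  · exact (h.lt_right a c ha hlt hc).le

theorem F_lt (h : IsPartialMoments F M μ₀) {a c : ℝ} (ha : 0 ≤ a) (hac : a < c) (hc : c ≤ 1) :
    F a < F c := by
  have h1 := h.lt_left a c ha hac hc
  have h2 := h.lt_right a c ha hac hc
  by_contra! hle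
  nlinarith

theorem F_le (h : IsPartialMoments F M μ₀) {a c : ℝ} (ha : 0 ≤ a) (hac : a ≤ c) (hc : c ≤ 1) :
    F a ≤ F c := by
  rcases hac.eq_or_lt with rfl | hlt
  · rfl
  · exact (h.F_lt ha hlt hc).le

theorem M_lt (h : IsPartialMoments F M μ₀) {a c : ℝ} (ha : 0 ≤ a) (hac : a < c) (hc : c ≤ 1) :
    M a < M c := by
  have h1 := h.lt_left a c ha hac hc
  have h2 := h.F_lt ha hac hc
  nlinarith [mul_nonneg ha (sub_pos.2 h2).le]

theorem mean_pos (h : IsPartialMoments F M μ₀) : 0 < μ₀ := by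
  have := h.M_lt le_rfl zero_lt_one le_rfl
  rwa [h.M_zero, h.M_one] at this

theorem mean_lt_one (h : IsPartialMoments F M μ₀) : μ₀ < 1 := by
  have := h.lt_right 0 1 le_rfl zero_lt_one le_rfl
  rw [h.M_zero, h.M_one, h.F_zero, h.F_one] at this
  linarith

/-- Raising `l` to `l'` raises the target belief for the whole pool, and the truthful signals it
adds have mean below `l'`. The latter gives strictness, as `α > 0`. -/
theorem strictMonoOn_lowerExcess (h : IsPartialMoments F M μ₀) (hα0 : 0 < α) (hα1 : α ≤ 1)
    {b : ℝ} (hb : b ∈ Icc (0 : ℝ) 1) :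
    StrictMonoOn (fun l => lowerExcess F M μ₀ α l b) (Icc 0 1) := by
  intro l hl l' hl' hlt
  have h1 := h.lt_right l l' hl.1 hlt hl'.2
  have h2 : 0 ≤ F l := h.F_zero ▸ h.F_le le_rfl hl.1 hl.2
  have h3 : F b ≤ 1 := h.F_one ▸ h.F_le hb.1 hb.2 le_rfl
  have e : lowerExcess F M μ₀ α l' b - lowerExcess F M μ₀ α l b =
      α * ((l' - l) * F l + (l' * (F l' - F l) - (M l' - M l))) +
        (1 - α) * ((l' - l) * (1 - F b)) := by
    simp only [lowerExcess]; ring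
  have p1 : 0 ≤ (l' - l) * F l := mul_nonneg (sub_pos.2 hlt).le h2
  have p2 : 0 ≤ (1 - α) * ((l' - l) * (1 - F b)) :=
    mul_nonneg (sub_nonneg.2 hα1) (mul_nonneg (sub_pos.2 hlt).le (sub_nonneg.2 h3))
  have p3 : 0 < α * ((l' - l) * F l + (l' * (F l' - F l) - (M l' - M l))) :=
    mul_pos hα0 (by linarith)
  exact sub_pos.1 (by rw [e]; linarith)

theorem strictMonoOn_upperExcess (h : IsPartialMoments F M μ₀) (hα0 : 0 < α) (hα1 : α ≤ 1)
    {b : ℝ} (hb : b ∈ Icc (0 : ℝ) 1) :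
    StrictMonoOn (fun l => upperExcess F M μ₀ α l b) (Icc 0 1) := by
  intro l hl l' hl' hlt
  have h1 := h.lt_left l l' hl.1 hlt hl'.2
  have h2 : 0 ≤ F b := h.F_zero ▸ h.F_le le_rfl hb.1 hb.2
  have h3 : F l' ≤ 1 := h.F_one ▸ h.F_le hl'.1 hl'.2 le_rfl
  have e : upperExcess F M μ₀ α l' b - upperExcess F M μ₀ α l b =
      α * ((l' - l) * (1 - F l') + ((M l' - M l) - l * (F l' - F l))) +
        (1 - α) * ((l' - l) * F b) := by
    simp only [upperExcess]; ring
  have p1 : 0 ≤ (l' - l) * (1 - F l') := mul_nonneg (sub_pos.2 hlt).le (sub_nonneg.2 h3)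
  have p2 : 0 ≤ (1 - α) * ((l' - l) * F b) :=
    mul_nonneg (sub_nonneg.2 hα1) (mul_nonneg (sub_pos.2 hlt).le h2)
  have p3 : 0 < α * ((l' - l) * (1 - F l') + ((M l' - M l) - l * (F l' - F l))) :=
    mul_pos hα0 (by linarith)
  exact sub_pos.1 (by rw [e]; linarith)

/-- Raising the threshold removes from the pool the signals between `b` and `b'`. They exceed `l`
because `l ≤ b`, so the pool's excess over its mean cannot fall. -/
theorem lowerExcess_le (h : IsPartialMoments F M μ₀) (hα1 : α ≤ 1) {l b b' : ℝ} (h0 : 0 ≤ l)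
    (hl : l ≤ b) (hb : b ≤ b') (hb' : b' ≤ 1) :
    lowerExcess F M μ₀ α l b ≤ lowerExcess F M μ₀ α l b' := by
  have h1 := h.le_left (h0.trans hl) hb hb'
  have h2 := h.F_le (h0.trans hl) hb hb'
  have e : lowerExcess F M μ₀ α l b' - lowerExcess F M μ₀ α l b =
      (1 - α) * ((M b' - M b) - l * (F b' - F b)) := by simp only [lowerExcess]; ring
  refine sub_nonneg.1 (e ▸ mul_nonneg (sub_nonneg.2 hα1) ?_)
  nlinarith

theorem upperExcess_le (h : IsPartialMoments F M μ₀) (hα1 : α ≤ 1) {l b b' : ℝ} (h1 : l ≤ 1)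
    (h0 : 0 ≤ b) (hb : b ≤ b') (hl : b' ≤ l) :
    upperExcess F M μ₀ α l b ≤ upperExcess F M μ₀ α l b' := by
  have i1 := h.le_right h0 hb (hl.trans h1)
  have i2 := h.F_le h0 hb (hl.trans h1)
  have e : upperExcess F M μ₀ α l b' - upperExcess F M μ₀ α l b =
      (1 - α) * (l * (F b' - F b) - (M b' - M b)) := by simp only [upperExcess]; ring
  refine sub_nonneg.1 (e ▸ mul_nonneg (sub_nonneg.2 hα1) ?_)
  nlinarith

theorem half_excess_pos (h : IsPartialMoments F M μ₀) : 0 < μ₀ * F μ₀ - M μ₀ := by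
  have := h.lt_right 0 μ₀ le_rfl h.mean_pos h.mean_lt_one.le
  rw [h.F_zero, h.M_zero] at this
  linarith

/-- The quantity is the integral of `μ₀ - x` over signals `x` up to `b`, and the integrand changes
sign at `μ₀`. -/
theorem half_excess_le (h : IsPartialMoments F M μ₀) {b : ℝ} (hb : b ∈ Icc (0 : ℝ) 1) :
    μ₀ * F b - M b ≤ μ₀ * F μ₀ - M μ₀ := by
  rcases le_total b μ₀ with hle | hle
  · have := h.le_right hb.1 hle h.mean_lt_one.le
    linarith
  · have := h.le_left h.mean_pos.le hle hb.2
    linarith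

/-- Here the bound `1/2` enters: the excess is `α` times the maximum of `μ₀ * F - M` minus `1 - α`
times another of its values. -/
theorem lowerExcess_mean_pos (h : IsPartialMoments F M μ₀) (hα : 1 / 2 < α) (hα1 : α ≤ 1)
    {b : ℝ} (hb : b ∈ Icc (0 : ℝ) 1) : 0 < lowerExcess F M μ₀ α μ₀ b := by
  have h1 := h.half_excess_pos
  have h2 := h.half_excess_le hb
  have e : lowerExcess F M μ₀ α μ₀ b =
      α * (μ₀ * F μ₀ - M μ₀) - (1 - α) * (μ₀ * F b - M b) := by simp only [lowerExcess]; ring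
  rw [e]
  nlinarith [mul_le_mul_of_nonneg_left h2 (sub_nonneg.2 hα1)]

theorem upperExcess_mean_neg (h : IsPartialMoments F M μ₀) (hα : 1 / 2 < α) (hα1 : α ≤ 1)
    {b : ℝ} (hb : b ∈ Icc (0 : ℝ) 1) : upperExcess F M μ₀ α μ₀ b < 0 := by
  have h1 := h.half_excess_pos
  have h2 := h.half_excess_le hb
  have e : upperExcess F M μ₀ α μ₀ b =
      (1 - α) * (μ₀ * F b - M b) - α * (μ₀ * F μ₀ - M μ₀) := by simp only [upperExcess]; ring
  rw [e]
  nlinarith [mul_le_mul_of_nonneg_left h2 (sub_nonneg.2 hα1)]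

theorem lowerExcess_zero_nonpos (h : IsPartialMoments F M μ₀) (hα1 : α ≤ 1)
    {b : ℝ} (hb : b ∈ Icc (0 : ℝ) 1) : lowerExcess F M μ₀ α 0 b ≤ 0 := by
  have h1 := h.le_left hb.1 hb.2 le_rfl
  have h2 := h.F_le hb.1 hb.2 le_rfl
  rw [h.M_one] at h1
  have : 0 ≤ (1 - α) * (μ₀ - M b) := mul_nonneg (sub_nonneg.2 hα1)
    ((mul_nonneg hb.1 (sub_nonneg.2 h2)).trans h1)
  simp only [lowerExcess, h.M_zero]
  linarith

theorem upperExcess_one_nonneg (h : IsPartialMoments F M μ₀) (hα1 : α ≤ 1)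
    {b : ℝ} (hb : b ∈ Icc (0 : ℝ) 1) : 0 ≤ upperExcess F M μ₀ α 1 b := by
  have h1 := h.le_right le_rfl hb.1 hb.2
  have h2 := h.F_le le_rfl hb.1 hb.2
  rw [h.M_zero, h.F_zero] at *
  simp only [upperExcess, h.F_one, h.M_one]
  have h3 : M b ≤ F b := by nlinarith [hb.2]
  linarith [mul_le_mul_of_nonneg_left h3 (sub_nonneg.2 hα1)]

theorem continuousOn_lowerExcess (h : IsPartialMoments F M μ₀) (b : ℝ) :
    ContinuousOn (fun l => lowerExcess F M μ₀ α l b) (Icc 0 1) := by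
  have := h.contF
  have := h.contM
  unfold lowerExcess
  fun_prop

theorem continuousOn_lowerExcess' (h : IsPartialMoments F M μ₀) (l : ℝ) :
    ContinuousOn (lowerExcess F M μ₀ α l) (Icc 0 1) := by
  have := h.contF
  have := h.contM
  unfold lowerExcess
  fun_prop

theorem continuousOn_upperExcess (h : IsPartialMoments F M μ₀) (b : ℝ) :
    ContinuousOn (fun l => upperExcess F M μ₀ α l b) (Icc 0 1) := by
  have := h.contF
  have := h.contM
  unfold upperExcess
  fun_prop

theorem continuousOn_upperExcess' (h : IsPartialMoments F M μ₀) (l : ℝ) :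
    ContinuousOn (upperExcess F M μ₀ α l) (Icc 0 1) := by
  have := h.contF
  have := h.contM
  unfold upperExcess
  fun_prop

end IsPartialMoments

namespace DecisionProblem

variable {A Θ : Type*} [TopologicalSpace A] [MeasurableSpace A] [MeasurableSpace Θ]
  {D : DecisionProblem A Θ} {F M : ℝ → ℝ} {μ₀ α : ℝ}

/-- Fixing `b` decouples the two conditions. Their solutions `L b` and `H b` are separated by `μ₀`
and continuous in `b`, so a one-dimensional intermediate value argument finds `b` equal to the
threshold of `L b` and `H b`. -/
theorem Regular.exists_zero_excess (hD : D.Regular) (h : IsPartialMoments F M μ₀)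
    (hα : 1 / 2 < α) (hα1 : α ≤ 1) :
    ∃ lo hi, 0 ≤ lo ∧ lo < μ₀ ∧ μ₀ < hi ∧ hi ≤ 1 ∧
      lowerExcess F M μ₀ α lo (D.threshold lo hi) = 0 ∧
      upperExcess F M μ₀ α hi (D.threshold lo hi) = 0 := by
  have hα0 : 0 < α := by linarith
  have h0 := h.mean_pos
  have h1 := h.mean_lt_one
  have hsub0 : Icc 0 μ₀ ⊆ Icc (0 : ℝ) 1 := Icc_subset_Icc_right h1.le
  have hsub1 : Icc μ₀ 1 ⊆ Icc (0 : ℝ) 1 := Icc_subset_Icc_left h0.le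
  have hL : ∀ b : ℝ, ∃ l, b ∈ Icc (0 : ℝ) 1 → (0 ≤ l ∧ l < μ₀) ∧ lowerExcess F M μ₀ α l b = 0 := by
    intro b
    by_cases hb : b ∈ Icc (0 : ℝ) 1
    · obtain ⟨l, hl, hz⟩ := intermediate_value_Ico h0.le
        ((h.continuousOn_lowerExcess (α := α) b).mono hsub0)
        ⟨h.lowerExcess_zero_nonpos hα1 hb, h.lowerExcess_mean_pos hα hα1 hb⟩
      exact ⟨l, fun _ => ⟨hl, hz⟩⟩
    · exact ⟨0, fun hb' => absurd hb' hb⟩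
  have hH : ∀ b : ℝ, ∃ l, b ∈ Icc (0 : ℝ) 1 → (μ₀ < l ∧ l ≤ 1) ∧ upperExcess F M μ₀ α l b = 0 := by
    intro b
    by_cases hb : b ∈ Icc (0 : ℝ) 1
    · obtain ⟨l, hl, hz⟩ := intermediate_value_Ioc h1.le
        ((h.continuousOn_upperExcess (α := α) b).mono hsub1)
        ⟨h.upperExcess_mean_neg hα hα1 hb, h.upperExcess_one_nonneg hα1 hb⟩
      exact ⟨l, fun _ => ⟨hl, hz⟩⟩
    · exact ⟨0, fun hb' => absurd hb' hb⟩
  choose L hL using hL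
  choose H hH using hH
  have hLI : ∀ b ∈ Icc (0 : ℝ) 1, L b ∈ Icc (0 : ℝ) 1 := fun b hb =>
    ⟨(hL b hb).1.1, (hL b hb).1.2.le.trans h1.le⟩
  have hHI : ∀ b ∈ Icc (0 : ℝ) 1, H b ∈ Icc (0 : ℝ) 1 := fun b hb =>
    ⟨h0.le.trans (hH b hb).1.1.le, (hH b hb).1.2⟩
  have hLH : ∀ b ∈ Icc (0 : ℝ) 1, L b < H b := fun b hb => (hL b hb).1.2.trans (hH b hb).1.1
  have cL : ContinuousOn L (Icc 0 1) := continuousOn_of_strictMonoOn_zero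
    (fun l _ => h.continuousOn_lowerExcess' l)
    (fun b hb => h.strictMonoOn_lowerExcess hα0 hα1 hb) hLI fun b hb => (hL b hb).2
  have cH : ContinuousOn H (Icc 0 1) := continuousOn_of_strictMonoOn_zero
    (fun l _ => h.continuousOn_upperExcess' l)
    (fun b hb => h.strictMonoOn_upperExcess hα0 hα1 hb) hHI fun b hb => (hH b hb).2
  have cT : ContinuousOn (fun b => D.threshold (L b) (H b)) (Icc 0 1) := by
    refine ContinuousOn.congr (f := fun b =>
      (H b * D.indirect' (H b) - D.indirect (H b) -
        (L b * D.indirect' (L b) - D.indirect (L b))) /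
        (D.indirect' (H b) - D.indirect' (L b))) ?_
      fun b hb => hD.threshold_eq (hLI b hb).1 (hLH b hb) (hHI b hb).2
    have c1 := hD.diff.continuousOn.comp cL hLI
    have c2 := hD.diff.continuousOn.comp cH hHI
    have c3 := hD.diff'.continuousOn.comp cL hLI
    have c4 := hD.diff'.continuousOn.comp cH hHI
    exact (((cH.mul c4).sub c2).sub ((cL.mul c3).sub c1)).div (c4.sub c3) fun b hb =>
      (sub_pos.2 (hD.strictMonoOn_indirect' (hLI b hb) (hHI b hb) (hLH b hb))).ne'
  have hT : ∀ b ∈ Icc (0 : ℝ) 1, D.threshold (L b) (H b) ∈ Icc (0 : ℝ) 1 := fun b hb => by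
    have := hD.threshold_mem_Icc (hLI b hb).1 (hLH b hb).le (hHI b hb).2
    exact ⟨(hLI b hb).1.trans this.1, this.2.trans (hHI b hb).2⟩
  have m0 : (0 : ℝ) ∈ Icc (0 : ℝ) 1 := ⟨le_rfl, zero_le_one⟩
  have m1 : (1 : ℝ) ∈ Icc (0 : ℝ) 1 := ⟨zero_le_one, le_rfl⟩
  obtain ⟨b, hb, hbz⟩ := intermediate_value_Icc (zero_le_one' ℝ) (continuousOn_id.sub cT)
    (show (0 : ℝ) ∈ Icc _ _ from ⟨by simpa using (hT 0 m0).1, by simpa using (hT 1 m1).2⟩)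
  have hbe : D.threshold (L b) (H b) = b := (sub_eq_zero.1 hbz).symm
  exact ⟨L b, H b, (hL b hb).1.1, (hL b hb).1.2, (hH b hb).1.1, (hH b hb).1.2,
    by rw [hbe]; exact (hL b hb).2, by rw [hbe]; exact (hH b hb).2⟩

/-- Both excesses rise weakly with the threshold on the relevant side and strictly with the end
point, so a higher threshold pushes their zeros down. -/
theorem Regular.le_of_zero_excess (hD : D.Regular) (h : IsPartialMoments F M μ₀)
    (hα0 : 0 < α) (hα1 : α ≤ 1) {lo hi lo' hi' : ℝ} (h0 : 0 ≤ lo) (hle : lo ≤ hi) (h1 : hi ≤ 1)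
    (h0' : 0 ≤ lo') (hle' : lo' ≤ hi') (h1' : hi' ≤ 1)
    (hl : lowerExcess F M μ₀ α lo (D.threshold lo hi) = 0)
    (hu : upperExcess F M μ₀ α hi (D.threshold lo hi) = 0)
    (hl' : lowerExcess F M μ₀ α lo' (D.threshold lo' hi') = 0)
    (hu' : upperExcess F M μ₀ α hi' (D.threshold lo' hi') = 0)
    (hb : D.threshold lo hi ≤ D.threshold lo' hi') : lo' ≤ lo ∧ hi' ≤ hi := by
  have hm := hD.threshold_mem_Icc h0 hle h1
  have hm' := hD.threshold_mem_Icc h0' hle' h1'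
  have hI : D.threshold lo hi ∈ Icc (0 : ℝ) 1 := ⟨h0.trans hm.1, hm.2.trans h1⟩
  have hI' : D.threshold lo' hi' ∈ Icc (0 : ℝ) 1 := ⟨h0'.trans hm'.1, hm'.2.trans h1'⟩
  constructor
  · by_contra! hlt
    have i1 := h.lowerExcess_le hα1 h0 hm.1 hb hI'.2
    have i2 := h.strictMonoOn_lowerExcess hα0 hα1 hI' ⟨h0, hle.trans h1⟩ ⟨h0', hle'.trans h1'⟩ hlt
    simp only at i2
    linarith
  · by_contra! hlt
    have i1 := h.upperExcess_le hα1 h1' hI.1 hb hm'.2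
    have i2 := h.strictMonoOn_upperExcess hα0 hα1 hI ⟨h0.trans hle, h1⟩ ⟨h0'.trans hle', h1'⟩ hlt
    simp only at i2
    linarith

/-- Two opposite monotonicities: the solution with the larger threshold has the lower end points,
hence by `threshold_mono` the smaller threshold. -/
theorem Regular.unique_zero_excess (hD : D.Regular) (h : IsPartialMoments F M μ₀)
    (hα0 : 0 < α) (hα1 : α ≤ 1) {lo hi lo' hi' : ℝ} (h0 : 0 ≤ lo) (hle : lo ≤ hi) (h1 : hi ≤ 1)
    (h0' : 0 ≤ lo') (hle' : lo' ≤ hi') (h1' : hi' ≤ 1)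
    (hl : lowerExcess F M μ₀ α lo (D.threshold lo hi) = 0)
    (hu : upperExcess F M μ₀ α hi (D.threshold lo hi) = 0)
    (hl' : lowerExcess F M μ₀ α lo' (D.threshold lo' hi') = 0)
    (hu' : upperExcess F M μ₀ α hi' (D.threshold lo' hi') = 0) : lo' = lo ∧ hi' = hi := by
  have hb : D.threshold lo hi = D.threshold lo' hi' := by
    rcases le_total (D.threshold lo hi) (D.threshold lo' hi') with hb | hb
    · have i := hD.le_of_zero_excess h hα0 hα1 h0 hle h1 h0' hle' h1' hl hu hl' hu' hb
      exact le_antisymm hb (hD.threshold_mono h0' i.1 hle hle' i.2 h1)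
    · have i := hD.le_of_zero_excess h hα0 hα1 h0' hle' h1' h0 hle h1 hl' hu' hl hu hb
      exact le_antisymm (hD.threshold_mono h0 i.1 hle' hle i.2 h1') hb
  have i := hD.le_of_zero_excess h hα0 hα1 h0 hle h1 h0' hle' h1' hl hu hl' hu' hb.le
  have i' := hD.le_of_zero_excess h hα0 hα1 h0' hle' h1' h0 hle h1 hl' hu' hl hu hb.ge
  exact ⟨le_antisymm i.1 i'.1, le_antisymm i.2 i'.2⟩

end DecisionProblem

/-! ### Moments of the signal law, linked to the balancing conditions. -/

/-- The distribution function of the density `τ` on `[0, 1]`. -/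
noncomputable def cdfOf (τ : ℝ → ℝ) (x : ℝ) : ℝ := ∫ t in (0 : ℝ)..x, τ t

/-- The partial mean of the density `τ` on `[0, 1]`. -/
noncomputable def partialMean (τ : ℝ → ℝ) (x : ℝ) : ℝ := ∫ t in (0 : ℝ)..x, t * τ t

namespace IsPositiveDensity

variable {τ : ℝ → ℝ}

theorem intervalIntegrable (hτ : IsPositiveDensity τ) : IntervalIntegrable τ volume 0 1 := by
  by_contra h
  -- The integral of a non-integrable function is 0 by default, whereas `τ` integrates to 1.
  exact zero_ne_one ((intervalIntegral.integral_undef h).symm.trans hτ.integral_eq_one)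

theorem intervalIntegrable_mul (hτ : IsPositiveDensity τ) {g : ℝ → ℝ} (hg : Continuous g)
    {a c : ℝ} (ha : a ∈ Icc (0 : ℝ) 1) (hc : c ∈ Icc (0 : ℝ) 1) :
    IntervalIntegrable (fun x => g x * τ x) volume a c := by
  refine (hτ.intervalIntegrable.continuousOn_mul hg.continuousOn).mono_set ?_
  rw [uIcc_of_le (zero_le_one' ℝ)]
  exact uIcc_subset_Icc ha hc

theorem intervalIntegrable_of_mem (hτ : IsPositiveDensity τ) {a c : ℝ} (ha : a ∈ Icc (0 : ℝ) 1)
    (hc : c ∈ Icc (0 : ℝ) 1) : IntervalIntegrable τ volume a c := by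
  simpa using hτ.intervalIntegrable_mul (g := fun _ => 1) continuous_const ha hc

theorem integral_eq_cdfOf_sub (hτ : IsPositiveDensity τ) {a c : ℝ} (ha : a ∈ Icc (0 : ℝ) 1)
    (hc : c ∈ Icc (0 : ℝ) 1) : ∫ x in a..c, τ x = cdfOf τ c - cdfOf τ a :=
  (intervalIntegral.integral_interval_sub_left
    (hτ.intervalIntegrable_of_mem ⟨le_rfl, zero_le_one⟩ hc)
    (hτ.intervalIntegrable_of_mem ⟨le_rfl, zero_le_one⟩ ha)).symm

theorem integral_eq_partialMean_sub (hτ : IsPositiveDensity τ) {a c : ℝ} (ha : a ∈ Icc (0 : ℝ) 1)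
    (hc : c ∈ Icc (0 : ℝ) 1) : ∫ x in a..c, x * τ x = partialMean τ c - partialMean τ a :=
  (intervalIntegral.integral_interval_sub_left
    (hτ.intervalIntegrable_mul continuous_id ⟨le_rfl, zero_le_one⟩ hc)
    (hτ.intervalIntegrable_mul continuous_id ⟨le_rfl, zero_le_one⟩ ha)).symm

theorem isPartialMoments (hτ : IsPositiveDensity τ) :
    IsPartialMoments (cdfOf τ) (partialMean τ) (prior τ) where
  contF := by
    have := intervalIntegral.continuousOn_primitive_interval' hτ.intervalIntegrable left_mem_uIcc
    rwa [uIcc_of_le (zero_le_one' ℝ)] at this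
  contM := by
    have := intervalIntegral.continuousOn_primitive_interval'
      (hτ.intervalIntegrable_mul continuous_id ⟨le_rfl, zero_le_one⟩ ⟨zero_le_one, le_rfl⟩)
      left_mem_uIcc
    rwa [uIcc_of_le (zero_le_one' ℝ)] at this
  F_zero := intervalIntegral.integral_same
  M_zero := intervalIntegral.integral_same
  F_one := hτ.integral_eq_one
  M_one := rfl
  lt_left a c ha hac hc := by
    have hca : c ∈ Icc (0 : ℝ) 1 := ⟨ha.trans hac.le, hc⟩
    have haa : a ∈ Icc (0 : ℝ) 1 := ⟨ha, hac.le.trans hc⟩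
    have hid : IntervalIntegrable (fun x => x * τ x) volume a c :=
      hτ.intervalIntegrable_mul continuous_id haa hca
    rw [← hτ.integral_eq_cdfOf_sub haa hca, ← hτ.integral_eq_partialMean_sub haa hca,
      ← intervalIntegral.integral_const_mul, ← sub_pos, ← intervalIntegral.integral_sub hid
        ((hτ.intervalIntegrable_of_mem haa hca).const_mul a)]
    refine intervalIntegral.intervalIntegral_pos_of_pos_on
      (hid.sub ((hτ.intervalIntegrable_of_mem haa hca).const_mul a)) (fun x hx => ?_) hac
    have := hτ.pos x ⟨ha.trans hx.1.le, hx.2.le.trans hc⟩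
    nlinarith [hx.1]
  lt_right a c ha hac hc := by
    have hca : c ∈ Icc (0 : ℝ) 1 := ⟨ha.trans hac.le, hc⟩
    have haa : a ∈ Icc (0 : ℝ) 1 := ⟨ha, hac.le.trans hc⟩
    have hid : IntervalIntegrable (fun x => x * τ x) volume a c :=
      hτ.intervalIntegrable_mul continuous_id haa hca
    rw [← hτ.integral_eq_cdfOf_sub haa hca, ← hτ.integral_eq_partialMean_sub haa hca,
      ← intervalIntegral.integral_const_mul, ← sub_pos, ← intervalIntegral.integral_sub
        ((hτ.intervalIntegrable_of_mem haa hca).const_mul c) hid]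
    refine intervalIntegral.intervalIntegral_pos_of_pos_on
      (((hτ.intervalIntegrable_of_mem haa hca).const_mul c).sub hid) (fun x hx => ?_) hac
    have := hτ.pos x ⟨ha.trans hx.1.le, hx.2.le.trans hc⟩
    nlinarith [hx.2]

theorem ae_signalLaw_iff (hτ : IsPositiveDensity τ) {P : unitInterval → Prop} :
    (∀ᵐ s ∂(signalLaw τ), P s) ↔ ∀ᵐ s : unitInterval, P s := by
  have hm : Measurable fun s : unitInterval => ENNReal.ofReal (τ s) :=
    (hτ.measurable.comp measurable_subtype_coe).ennreal_ofReal
  rw [signalLaw, ae_withDensity_iff hm]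
  refine Filter.eventually_congr (.of_forall fun s => ?_)
  simp [hτ.pos s s.2]

theorem setIntegral_signalLaw (hτ : IsPositiveDensity τ) (G : ℝ → ℝ) {S : Set ℝ}
    (hS : MeasurableSet S) :
    ∫ s in ((↑) : unitInterval → ℝ) ⁻¹' S, G s ∂(signalLaw τ) =
      ∫ x in S ∩ Icc 0 1, G x * τ x := by
  have hm : Measurable fun s : unitInterval => ENNReal.ofReal (τ s) :=
    (hτ.measurable.comp measurable_subtype_coe).ennreal_ofReal
  have hS' := measurable_subtype_coe (p := fun x => x ∈ Icc (0 : ℝ) 1) hS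
  rw [signalLaw, restrict_withDensity hS',
    integral_withDensity_eq_integral_toReal_smul hm (.of_forall fun _ => ENNReal.ofReal_lt_top)]
  have : ∀ s : unitInterval, (ENNReal.ofReal (τ s)).toReal • G s = G s * τ s := fun s => by
    rw [ENNReal.toReal_ofReal (hτ.pos s s.2).le, smul_eq_mul, mul_comm]
  simp only [this]
  rw [← Measure.restrict_restrict hS]
  exact unitInterval.measurePreserving_coe.setIntegral_preimage_emb
    unitInterval.measurableEmbedding_coe (fun x => G x * τ x) S

theorem integral_signalLaw (hτ : IsPositiveDensity τ) (G : ℝ → ℝ) :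
    ∫ s : unitInterval, G s ∂(signalLaw τ) = ∫ x in (0 : ℝ)..1, G x * τ x := by
  have := hτ.setIntegral_signalLaw G MeasurableSet.univ
  rw [preimage_univ, Measure.restrict_univ, univ_inter] at this
  rw [this, intervalIntegral.integral_of_le zero_le_one, integral_Icc_eq_integral_Ioc]

theorem setIntegral_signalLaw_le (hτ : IsPositiveDensity τ) (G : ℝ → ℝ) {b : ℝ}
    (hb : b ∈ Icc (0 : ℝ) 1) :
    ∫ s in {s : unitInterval | (s : ℝ) ≤ b}, G s ∂(signalLaw τ) = ∫ x in (0 : ℝ)..b, G x * τ x := by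
  have := hτ.setIntegral_signalLaw G (measurableSet_Iic (a := b))
  have e : Iic b ∩ Icc (0 : ℝ) 1 = Icc 0 b := by
    ext x; simp only [mem_inter_iff, mem_Iic, mem_Icc]
    exact ⟨fun h => ⟨h.2.1, h.1⟩, fun h => ⟨h.2, h.1, h.2.trans hb.2⟩⟩
  rw [e] at this
  rw [intervalIntegral.integral_of_le hb.1, ← integral_Icc_eq_integral_Ioc, ← this]
  rfl

theorem isProbabilityMeasure_signalLaw (hτ : IsPositiveDensity τ) :
    IsProbabilityMeasure (signalLaw τ) := by
  have hm : Measurable fun s : unitInterval => ENNReal.ofReal (τ s) :=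
    (hτ.measurable.comp measurable_subtype_coe).ennreal_ofReal
  constructor
  have hi : IntegrableOn τ (Icc 0 1) volume := by
    have := hτ.intervalIntegrable
    rwa [intervalIntegrable_iff_integrableOn_Icc_of_le zero_le_one] at this
  rw [signalLaw, withDensity_apply _ MeasurableSet.univ, Measure.restrict_univ,
    unitInterval.measurePreserving_coe.lintegral_comp (f := fun x => ENNReal.ofReal (τ x))
      hτ.measurable.ennreal_ofReal]
  rw [← ofReal_integral_eq_lintegral_ofReal hi, integral_Icc_eq_integral_Ioc,
    ← intervalIntegral.integral_of_le zero_le_one, hτ.integral_eq_one, ENNReal.ofReal_one]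
  filter_upwards [ae_restrict_mem measurableSet_Icc] with x hx using (hτ.pos x hx).le

end IsPositiveDensity

namespace DecisionProblem

variable {A Θ : Type*} [TopologicalSpace A] [MeasurableSpace A] [MeasurableSpace Θ]
  {D : DecisionProblem A Θ} {τ : ℝ → ℝ} {α lo hi : ℝ}

theorem Regular.threshold_mem_unit (hD : D.Regular) (h0 : 0 ≤ lo) (hle : lo ≤ hi) (h1 : hi ≤ 1) :
    D.threshold lo hi ∈ Icc (0 : ℝ) 1 := by
  have := hD.threshold_mem_Icc h0 hle h1
  exact ⟨h0.trans this.1, this.2.trans h1⟩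

theorem Regular.balanced_iff (hD : D.Regular) (hτ : IsPositiveDensity τ) (h0 : 0 ≤ lo)
    (hle : lo ≤ hi) (h1 : hi ≤ 1) :
    D.Balanced τ α lo hi ↔
      lowerExcess (cdfOf τ) (partialMean τ) (prior τ) α lo (D.threshold lo hi) = 0 ∧
      upperExcess (cdfOf τ) (partialMean τ) (prior τ) α hi (D.threshold lo hi) = 0 := by
  have hb := hD.threshold_mem_unit h0 hle h1
  have hm := hτ.isPartialMoments
  have hl : lo ∈ Icc (0 : ℝ) 1 := ⟨h0, hle.trans h1⟩
  have hh : hi ∈ Icc (0 : ℝ) 1 := ⟨h0.trans hle, h1⟩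
  have hz : (0 : ℝ) ∈ Icc (0 : ℝ) 1 := ⟨le_rfl, zero_le_one⟩
  have ho : (1 : ℝ) ∈ Icc (0 : ℝ) 1 := ⟨zero_le_one, le_rfl⟩
  simp only [Balanced, num₁, num₂, den₁, den₂, lowerExcess, upperExcess,
    hτ.integral_eq_cdfOf_sub hb ho, hτ.integral_eq_cdfOf_sub hh ho,
    hτ.integral_eq_cdfOf_sub hz hl, hτ.integral_eq_cdfOf_sub hz hb,
    hτ.integral_eq_partialMean_sub hb ho, hτ.integral_eq_partialMean_sub hh ho,
    hτ.integral_eq_partialMean_sub hz hl, hτ.integral_eq_partialMean_sub hz hb,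
    hm.F_zero, hm.M_zero, hm.F_one, hm.M_one, sub_zero]
  constructor <;> rintro ⟨e1, e2⟩ <;> constructor <;> linarith

theorem Regular.den_pos (hD : D.Regular) (hτ : IsPositiveDensity τ) (hα0 : 0 ≤ α) (hα1 : α < 1)
    (h0 : 0 ≤ lo) (hlo : lo ≤ prior τ) (hhi : prior τ ≤ hi) (h1 : hi ≤ 1) :
    0 < D.den₁ τ α lo hi ∧ 0 < D.den₂ τ α lo hi := by
  have hm := hτ.isPartialMoments
  have hle := hlo.trans hhi
  have hb := hD.threshold_mem_unit h0 hle h1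
  have hl : lo ∈ Icc (0 : ℝ) 1 := ⟨h0, hle.trans h1⟩
  have hh : hi ∈ Icc (0 : ℝ) 1 := ⟨h0.trans hle, h1⟩
  have hz : (0 : ℝ) ∈ Icc (0 : ℝ) 1 := ⟨le_rfl, zero_le_one⟩
  have ho : (1 : ℝ) ∈ Icc (0 : ℝ) 1 := ⟨zero_le_one, le_rfl⟩
  have hb' : 0 < D.threshold lo hi ∧ D.threshold lo hi < 1 := by
    rcases hle.eq_or_lt with he | hlt
    · subst he
      rw [threshold_self, le_antisymm hlo hhi]
      exact ⟨hm.mean_pos, hm.mean_lt_one⟩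
    · have := hD.threshold_mem_Ioo h0 hlt h1
      exact ⟨h0.trans_lt this.1, this.2.trans_le h1⟩
  have i1 := hm.F_lt hb.1 hb'.2 le_rfl
  have i2 := hm.F_lt le_rfl hb'.1 hb.2
  have i3 := hm.F_le le_rfl hl.1 hl.2
  have i4 := hm.F_le hh.1 hh.2 le_rfl
  simp only [den₁, den₂, hτ.integral_eq_cdfOf_sub hb ho, hτ.integral_eq_cdfOf_sub hh ho,
    hτ.integral_eq_cdfOf_sub hz hl, hτ.integral_eq_cdfOf_sub hz hb]
  exact ⟨add_pos_of_nonneg_of_pos (mul_nonneg hα0 (sub_nonneg.2 i3))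
      (mul_pos (sub_pos.2 hα1) (sub_pos.2 i1)),
    add_pos_of_nonneg_of_pos (mul_nonneg hα0 (sub_nonneg.2 i4))
      (mul_pos (sub_pos.2 hα1) (sub_pos.2 i2))⟩

end DecisionProblem

/-! ### Message laws, induced beliefs and expected payoffs. -/

theorem integral_bind_kernel {X Y : Type*} [MeasurableSpace X] [MeasurableSpace Y] (ν : Measure X)
    (κ : Kernel X Y) {f : Y → ℝ} (hf : Integrable f (ν.bind κ)) :
    ∫ y, f y ∂(ν.bind κ) = ∫ x, ∫ y, f y ∂(κ x) ∂ν := by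
  rw [Measure.comp_eq_comp_const_apply] at hf ⊢
  rw [Kernel.integral_comp hf, Kernel.const_apply]

theorem measurable_ofReal_weight (ω : Fin 2) :
    Measurable fun s : unitInterval => ENNReal.ofReal (weight s ω) :=
  ((continuous_weight ω).comp continuous_subtype_val).measurable.ennreal_ofReal

theorem weight_unit_nonneg (s : unitInterval) (ω : Fin 2) : 0 ≤ weight s ω :=
  weight_nonneg s.2.1 s.2.2 ω

theorem weight_unit_le_one (s : unitInterval) (ω : Fin 2) : weight s ω ≤ 1 := by
  fin_cases ω
  · exact sub_le_self _ s.2.1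
  · exact s.2.2

section

variable {τ : ℝ → ℝ}

theorem isFiniteMeasure_signalStateLaw (hτ : IsPositiveDensity τ) (ω : Fin 2) :
    IsFiniteMeasure (signalStateLaw τ ω) := by
  have := hτ.isProbabilityMeasure_signalLaw
  refine isFiniteMeasure_withDensity (ne_of_lt ?_)
  calc ∫⁻ s, ENNReal.ofReal (weight s ω) ∂(signalLaw τ) ≤ ∫⁻ _, 1 ∂(signalLaw τ) :=
        lintegral_mono fun s => ENNReal.ofReal_le_one.2 (weight_unit_le_one s ω)
    _ < ∞ := by simp

theorem isFiniteMeasure_bind {X Y : Type*} [MeasurableSpace X] [MeasurableSpace Y] (ν : Measure X)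
    [IsFiniteMeasure ν] (κ : Kernel X Y) [IsMarkovKernel κ] : IsFiniteMeasure (ν.bind κ) := by
  constructor
  rw [Measure.bind_apply MeasurableSet.univ κ.aemeasurable]
  simp

namespace DecisionProblem

variable {A Θ : Type*} [TopologicalSpace A] [MeasurableSpace A] [MeasurableSpace Θ]
  (D : DecisionProblem A Θ)

theorem integrable_profile_after (σ : Strategy A Θ) (ω : Fin 2) (ν : Measure unitInterval)
    [IsFiniteMeasure ν] : Integrable (fun m => D.profile (σ.after m) ω) ν := by
  obtain ⟨C, hC⟩ := D.exists_bound_profile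
  exact Integrable.of_bound (D.measurable_profile_after σ ω).aestronglyMeasurable C
    (.of_forall fun m => hC _ ω)

theorem measurable_payoff_after (σ : Strategy A Θ) :
    Measurable fun p : unitInterval × unitInterval => D.payoff (σ.after p.2) p.1 := by
  have h : ∀ ω, Measurable fun p : unitInterval × unitInterval => D.profile (σ.after p.2) ω :=
    fun ω => (D.measurable_profile_after σ ω).comp measurable_snd
  have h1 : Measurable fun p : unitInterval × unitInterval => (p.1 : ℝ) :=
    measurable_subtype_coe.comp measurable_fst
  simp only [payoff_eq]
  exact ((measurable_const.sub h1).mul (h 0)).add (h1.mul (h 1))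

theorem integrable_payoff_kernel (σ : Strategy A Θ) (β : AdviserStrategy)
    (ν : Measure unitInterval) [IsFiniteMeasure ν] :
    Integrable (fun s => ∫ m, D.payoff (σ.after m) s ∂(β.1 s)) ν := by
  have := β.2
  obtain ⟨C, hC⟩ := D.exists_bound_payoff
  refine Integrable.of_bound ?_ C (.of_forall fun s => ?_)
  · exact (StronglyMeasurable.integral_kernel_prod_right (κ := β.1)
      (f := fun (s m : unitInterval) => D.payoff (σ.after m) s)
      (D.measurable_payoff_after σ).stronglyMeasurable).aestronglyMeasurable
  · simpa using norm_integral_le_of_norm_le_const (μ := β.1 s)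
      (f := fun m => D.payoff (σ.after m) s) (C := C) (.of_forall fun m => hC _ _ s.2)

theorem integral_payoff (σ : Strategy A Θ) (ν : Measure unitInterval) [IsFiniteMeasure ν]
    (x : ℝ) : ∫ m, D.payoff (σ.after m) x ∂ν =
      ∑ ω, weight x ω * ∫ m, D.profile (σ.after m) ω ∂ν := by
  simp only [payoff]
  rw [integral_finsetSum _ fun ω _ => (D.integrable_profile_after σ ω ν).const_mul _]
  simp only [integral_const_mul]

/-- Integrating the signal out leaves one law of messages for each state, and the adviser's strategy
matters only through these. -/
theorem expectedPayoff_eq_sum (hτ : IsPositiveDensity τ) (β : AdviserStrategy)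
    (σ : Strategy A Θ) : D.expectedPayoff τ β σ =
      ∑ ω, ∫ m, D.profile (σ.after m) ω ∂((signalStateLaw τ ω).bind β.1) := by
  have := hτ.isProbabilityMeasure_signalLaw
  have := β.2
  obtain ⟨C, hC⟩ := D.exists_bound_profile
  have hJm : ∀ ω, Measurable fun s => ∫ m, D.profile (σ.after m) ω ∂(β.1 s) := fun ω =>
    (D.measurable_profile_after σ ω).stronglyMeasurable.integral_kernel.measurable
  have hJb : ∀ ω s, ‖∫ m, D.profile (σ.after m) ω ∂(β.1 s)‖ ≤ C := fun ω s => by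
    simpa using norm_integral_le_of_norm_le_const (μ := β.1 s)
      (f := fun m => D.profile (σ.after m) ω) (C := C) (.of_forall fun m => hC _ ω)
  have hi : ∀ ω, Integrable (fun s : unitInterval =>
      weight s ω * ∫ m, D.profile (σ.after m) ω ∂(β.1 s)) (signalLaw τ) := fun ω => by
    refine Integrable.of_bound (((continuous_weight ω).comp
      continuous_subtype_val).measurable.mul (hJm ω)).aestronglyMeasurable C (.of_forall fun s => ?_)
    rw [norm_mul, Real.norm_of_nonneg (weight_unit_nonneg s ω)]
    exact (mul_le_of_le_one_left (norm_nonneg _) (weight_unit_le_one s ω)).trans (hJb ω s)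
  rw [expectedPayoff]
  simp only [integral_payoff]
  rw [integral_finsetSum _ fun ω _ => hi ω]
  refine Finset.sum_congr rfl fun ω _ => ?_
  have := isFiniteMeasure_signalStateLaw hτ ω
  have := isFiniteMeasure_bind (signalStateLaw τ ω) β.1
  rw [integral_bind_kernel _ _ (D.integrable_profile_after σ ω _), signalStateLaw,
    integral_withDensity_eq_integral_toReal_smul (measurable_ofReal_weight ω)
      (.of_forall fun _ => ENNReal.ofReal_lt_top)]
  simp only [ENNReal.toReal_ofReal (weight_unit_nonneg _ ω), smul_eq_mul]

theorem integral_messageStateLaw (hτ : IsPositiveDensity τ) {α : ℝ} (hα0 : 0 ≤ α) (hα1 : α ≤ 1)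
    (β : AdviserStrategy) (σ : Strategy A Θ) :
    α * D.expectedPayoff τ truthful σ + (1 - α) * D.expectedPayoff τ β σ =
      ∑ ω, ∫ m, D.profile (σ.after m) ω ∂(messageStateLaw τ α β ω) := by
  rw [D.expectedPayoff_eq_sum hτ, D.expectedPayoff_eq_sum hτ, Finset.mul_sum, Finset.mul_sum,
    ← Finset.sum_add_distrib]
  refine Finset.sum_congr rfl fun ω _ => ?_
  have := isFiniteMeasure_signalStateLaw hτ ω
  have := β.2
  have := truthful.2
  have := isFiniteMeasure_bind (signalStateLaw τ ω) β.1
  have := isFiniteMeasure_bind (signalStateLaw τ ω) truthful.1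
  rw [messageStateLaw, integral_add_measure
    ((D.integrable_profile_after σ ω _).smul_measure ENNReal.ofReal_ne_top)
    ((D.integrable_profile_after σ ω _).smul_measure ENNReal.ofReal_ne_top),
    integral_smul_measure, integral_smul_measure, ENNReal.toReal_ofReal hα0,
    ENNReal.toReal_ofReal (sub_nonneg.2 hα1), smul_eq_mul, smul_eq_mul]

end DecisionProblem

theorem isFiniteMeasure_messageLaw (hτ : IsPositiveDensity τ) (α : ℝ) (β : AdviserStrategy) :
    IsFiniteMeasure (messageLaw τ α β) := by
  have := β.2
  have := truthful.2
  have h1 := fun ω => isFiniteMeasure_signalStateLaw hτ ω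
  have h2 := fun ω => isFiniteMeasure_bind (signalStateLaw τ ω) β.1
  have h3 := fun ω => isFiniteMeasure_bind (signalStateLaw τ ω) truthful.1
  have h4 : ∀ ω, IsFiniteMeasure (messageStateLaw τ α β ω) := fun ω => by
    have := ((signalStateLaw τ ω).bind β.1).smul_finite
      (ENNReal.ofReal_ne_top (r := 1 - α))
    have := ((signalStateLaw τ ω).bind truthful.1).smul_finite
      (ENNReal.ofReal_ne_top (r := α))
    rw [messageStateLaw]
    infer_instance
  rw [messageLaw]
  infer_instance

/-- The message `m` induces the belief `p m`. -/
def InducesBelief (τ : ℝ → ℝ) (α : ℝ) (β : AdviserStrategy) (p : unitInterval → ℝ) : Prop :=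
  ∀ ω, messageStateLaw τ α β ω =
    (messageLaw τ α β).withDensity fun m => ENNReal.ofReal (weight (p m) ω)

theorem InducesBelief.posteriorBelief_ae_eq (hτ : IsPositiveDensity τ) {α : ℝ}
    {β : AdviserStrategy} {p : unitInterval → ℝ} (hp : Measurable p) (hp01 : ∀ m, p m ∈ Icc 0 1)
    (h : InducesBelief τ α β p) :
    ∀ᵐ m ∂(messageLaw τ α β), posteriorBelief τ α β m = p m := by
  have := isFiniteMeasure_messageLaw hτ α β
  filter_upwards [Measure.rnDeriv_withDensity (messageLaw τ α β)
    (f := fun m => ENNReal.ofReal (weight (p m) 1)) hp.ennreal_ofReal] with m hm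
  rw [posteriorBelief, h 1, hm, weight_one, ENNReal.toReal_ofReal (hp01 m).1]

/-- Conditioning on the message splits the agent's objective against `β` into one decision problem
per message, at the belief `p m`. Best replies can then be found message by message. -/
theorem InducesBelief.integral_payoff (hτ : IsPositiveDensity τ) {α : ℝ} (hα0 : 0 ≤ α)
    (hα1 : α ≤ 1) {β : AdviserStrategy} {p : unitInterval → ℝ} (hp : Measurable p)
    (hp01 : ∀ m, p m ∈ Icc 0 1) (h : InducesBelief τ α β p)
    {A Θ : Type*} [TopologicalSpace A] [MeasurableSpace A] [MeasurableSpace Θ]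
    (D : DecisionProblem A Θ) (σ : Strategy A Θ) :
    Integrable (fun m => D.payoff (σ.after m) (p m)) (messageLaw τ α β) ∧
    α * D.expectedPayoff τ truthful σ + (1 - α) * D.expectedPayoff τ β σ =
      ∫ m, D.payoff (σ.after m) (p m) ∂(messageLaw τ α β) := by
  have := isFiniteMeasure_messageLaw hτ α β
  obtain ⟨C, hC⟩ := D.exists_bound_profile
  have hw : ∀ ω, Measurable fun m => weight (p m) ω := fun ω =>
    (continuous_weight ω).measurable.comp hp
  have hi : ∀ ω, Integrable (fun m => weight (p m) ω * D.profile (σ.after m) ω)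
      (messageLaw τ α β) := fun ω => by
    refine Integrable.of_bound ((hw ω).mul
      (D.measurable_profile_after σ ω)).aestronglyMeasurable C (.of_forall fun m => ?_)
    rw [norm_mul, Real.norm_of_nonneg (weight_nonneg (hp01 m).1 (hp01 m).2 ω)]
    exact (mul_le_of_le_one_left (norm_nonneg _)
      (weight_unit_le_one ⟨p m, hp01 m⟩ ω)).trans (hC _ ω)
  refine ⟨integrable_finsetSum _ fun ω _ => hi ω, ?_⟩
  rw [D.integral_messageStateLaw hτ hα0 hα1]
  simp only [DecisionProblem.payoff]
  rw [integral_finsetSum _ fun ω _ => hi ω]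
  refine Finset.sum_congr rfl fun ω _ => ?_
  rw [h ω, integral_withDensity_eq_integral_toReal_smul (hw ω).ennreal_ofReal
      (.of_forall fun _ => ENNReal.ofReal_lt_top)]
  simp only [ENNReal.toReal_ofReal (weight_nonneg (hp01 _).1 (hp01 _).2 ω), smul_eq_mul]

theorem bind_truthful (ν : Measure unitInterval) : ν.bind truthful.1 = ν := by
  change ν.bind (Kernel.id) = ν
  simp

/-- Densities of the message on the two states, relative to the law of the signal, determine the
belief that a message induces. -/
theorem inducesBelief_of_density {α : ℝ} {β : AdviserStrategy} {g : Fin 2 → unitInterval → ℝ}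
    (hgm : ∀ ω, Measurable (g ω)) (hg : ∀ ω m, 0 ≤ g ω m)
    (hlaw : ∀ ω, messageStateLaw τ α β ω =
      (signalLaw τ).withDensity fun m => ENNReal.ofReal (g ω m)) :
    messageLaw τ α β = (signalLaw τ).withDensity (fun m => ENNReal.ofReal (g 0 m + g 1 m)) ∧
    ∀ p : unitInterval → ℝ, Measurable p → (∀ m, p m ∈ Icc (0 : ℝ) 1) →
      (∀ m, g 1 m = p m * (g 0 m + g 1 m)) → InducesBelief τ α β p := by
  have hsum : messageLaw τ α β =
      (signalLaw τ).withDensity (fun m => ENNReal.ofReal (g 0 m + g 1 m)) := by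
    rw [messageLaw, Fin.sum_univ_two, hlaw, hlaw, ← withDensity_add_left (hgm 0).ennreal_ofReal]
    congr 1
    funext m
    simp [ENNReal.ofReal_add (hg 0 m) (hg 1 m)]
  refine ⟨hsum, fun p hp hp01 hpg ω => ?_⟩
  have hw : Measurable fun m => weight (p m) ω := (continuous_weight ω).measurable.comp hp
  have hs : Measurable fun m => g 0 m + g 1 m := (hgm 0).add (hgm 1)
  rw [hlaw, hsum, ← withDensity_mul _ hs.ennreal_ofReal hw.ennreal_ofReal]
  congr 1
  funext m
  rw [Pi.mul_apply, ← ENNReal.ofReal_mul (add_nonneg (hg 0 m) (hg 1 m))]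
  congr 1
  have := hpg m
  fin_cases ω
  · change g 0 m = (g 0 m + g 1 m) * (1 - p m)
    linarith
  · change g 1 m = (g 0 m + g 1 m) * p m
    linarith

end

/-! ### Projection to the interval and the adviser's strategy that induces it. -/

/-- The point of `[lo, hi]` nearest to the message. -/
noncomputable def clamp (lo hi : ℝ) (m : unitInterval) : ℝ := max lo (min hi m)

section Clamp

variable {lo hi : ℝ}

theorem continuous_clamp (lo hi : ℝ) : Continuous (clamp lo hi) :=
  continuous_const.max (continuous_const.min continuous_subtype_val)

theorem clamp_mem (hle : lo ≤ hi) (m : unitInterval) : clamp lo hi m ∈ Icc lo hi :=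
  ⟨le_max_left _ _, max_le hle (min_le_left _ _)⟩

theorem clamp_of_le {m : unitInterval} (h : (m : ℝ) ≤ lo) : clamp lo hi m = lo :=
  max_eq_left ((min_le_right _ _).trans h)

theorem clamp_of_ge (hle : lo ≤ hi) {m : unitInterval} (h : hi ≤ (m : ℝ)) : clamp lo hi m = hi := by
  rw [clamp, min_eq_left h, max_eq_right hle]

theorem clamp_of_mem {m : unitInterval} (h : (m : ℝ) ∈ Icc lo hi) : clamp lo hi m = m := by
  rw [clamp, min_eq_right h.2, max_eq_right h.1]

end Clamp

namespace IsPositiveDensity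

variable {τ : ℝ → ℝ}

theorem integral_upper_part (hτ : IsPositiveDensity τ) {c : ℝ} (hc : c ∈ Icc (0 : ℝ) 1) :
    ∫ m : unitInterval, max ((m : ℝ) - c) 0 ∂(signalLaw τ) =
      (prior τ - partialMean τ c) - c * (1 - cdfOf τ c) := by
  have hz : (0 : ℝ) ∈ Icc (0 : ℝ) 1 := ⟨le_rfl, zero_le_one⟩
  have ho : (1 : ℝ) ∈ Icc (0 : ℝ) 1 := ⟨zero_le_one, le_rfl⟩
  have hcont : Continuous fun x : ℝ => max (x - c) 0 := by fun_prop
  have hid : IntervalIntegrable (fun x => x * τ x) volume c 1 :=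
    hτ.intervalIntegrable_mul continuous_id hc ho
  rw [hτ.integral_signalLaw fun x => max (x - c) 0,
    ← intervalIntegral.integral_add_adjacent_intervals (hτ.intervalIntegrable_mul hcont hz hc)
      (hτ.intervalIntegrable_mul hcont hc ho)]
  have e1 : ∫ x in (0 : ℝ)..c, max (x - c) 0 * τ x = ∫ x in (0 : ℝ)..c, (0 : ℝ) := by
    refine intervalIntegral.integral_congr fun x hx => ?_
    rw [uIcc_of_le hc.1] at hx
    simp only [max_eq_right (sub_nonpos.2 hx.2), zero_mul]
  have e2 : ∫ x in c..1, max (x - c) 0 * τ x = ∫ x in c..1, (x * τ x - c * τ x) := by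
    refine intervalIntegral.integral_congr fun x hx => ?_
    rw [uIcc_of_le hc.2] at hx
    simp only [max_eq_left (sub_nonneg.2 hx.1), sub_mul]
  rw [e1, e2, intervalIntegral.integral_sub hid
    ((hτ.intervalIntegrable_of_mem hc ho).const_mul c), intervalIntegral.integral_const_mul,
    hτ.integral_eq_cdfOf_sub hc ho, hτ.integral_eq_partialMean_sub hc ho,
    hτ.isPartialMoments.F_one, hτ.isPartialMoments.M_one]
  simp

theorem integral_lower_part (hτ : IsPositiveDensity τ) {c : ℝ} (hc : c ∈ Icc (0 : ℝ) 1) :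
    ∫ m : unitInterval, max (c - (m : ℝ)) 0 ∂(signalLaw τ) =
      c * cdfOf τ c - partialMean τ c := by
  have hz : (0 : ℝ) ∈ Icc (0 : ℝ) 1 := ⟨le_rfl, zero_le_one⟩
  have ho : (1 : ℝ) ∈ Icc (0 : ℝ) 1 := ⟨zero_le_one, le_rfl⟩
  have hcont : Continuous fun x : ℝ => max (c - x) 0 := by fun_prop
  have hid : IntervalIntegrable (fun x => x * τ x) volume 0 c :=
    hτ.intervalIntegrable_mul continuous_id hz hc
  rw [hτ.integral_signalLaw fun x => max (c - x) 0,
    ← intervalIntegral.integral_add_adjacent_intervals (hτ.intervalIntegrable_mul hcont hz hc)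
      (hτ.intervalIntegrable_mul hcont hc ho)]
  have e1 : ∫ x in c..1, max (c - x) 0 * τ x = ∫ x in c..1, (0 : ℝ) := by
    refine intervalIntegral.integral_congr fun x hx => ?_
    rw [uIcc_of_le hc.2] at hx
    simp only [max_eq_right (sub_nonpos.2 hx.1), zero_mul]
  have e2 : ∫ x in (0 : ℝ)..c, max (c - x) 0 * τ x = ∫ x in (0 : ℝ)..c, (c * τ x - x * τ x) := by
    refine intervalIntegral.integral_congr fun x hx => ?_
    rw [uIcc_of_le hc.1] at hx
    simp only [max_eq_left (sub_nonneg.2 hx.2), sub_mul]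
  rw [e1, e2, intervalIntegral.integral_sub
    ((hτ.intervalIntegrable_of_mem hz hc).const_mul c) hid, intervalIntegral.integral_const_mul,
    hτ.integral_eq_cdfOf_sub hz hc, hτ.integral_eq_partialMean_sub hz hc,
    hτ.isPartialMoments.F_zero, hτ.isPartialMoments.M_zero]
  simp

/-- A mixture of the signal law with a normalized density is a probability measure. -/
theorem isProbabilityMeasure_mixture (hτ : IsPositiveDensity τ) {h : unitInterval → ℝ} {K c : ℝ}
    (h0 : ∀ m, 0 ≤ h m) (hK : ∫ m, h m ∂(signalLaw τ) = K) (hK0 : 0 < K)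
    (hc0 : 0 ≤ c) (hc1 : c ≤ 1) :
    IsProbabilityMeasure
      ((signalLaw τ).withDensity fun m => ENNReal.ofReal (c * (h m / K) + (1 - c))) := by
  have := hτ.isProbabilityMeasure_signalLaw
  have hi : Integrable h (signalLaw τ) := by
    by_contra hn
    rw [integral_undef hn] at hK
    exact hK0.ne hK
  have hi' : Integrable (fun m => c * (h m / K) + (1 - c)) (signalLaw τ) :=
    ((hi.div_const K).const_mul c).add (integrable_const _)
  constructor
  rw [withDensity_apply _ MeasurableSet.univ, Measure.restrict_univ,
    ← ofReal_integral_eq_lintegral_ofReal hi' (.of_forall fun m =>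
      add_nonneg (mul_nonneg hc0 (div_nonneg (h0 m) hK0.le)) (sub_nonneg.2 hc1)),
    integral_add ((hi.div_const K).const_mul c) (integrable_const _), integral_const_mul,
    integral_div, hK, div_self hK0.ne']
  simp

/-- The mass that the signal and the state put on signals up to `b`. -/
theorem signalStateLaw_le (hτ : IsPositiveDensity τ) {b : ℝ} (hb : b ∈ Icc (0 : ℝ) 1) (ω : Fin 2) :
    signalStateLaw τ ω {s | (s : ℝ) ≤ b} =
      ENNReal.ofReal (∫ x in (0 : ℝ)..b, weight x ω * τ x) := by
  have := hτ.isProbabilityMeasure_signalLaw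
  have hS : MeasurableSet {s : unitInterval | (s : ℝ) ≤ b} :=
    measurableSet_le measurable_subtype_coe measurable_const
  have hi : Integrable (fun s : unitInterval => weight s ω) (signalLaw τ) :=
    Integrable.of_bound ((continuous_weight ω).comp
      continuous_subtype_val).measurable.aestronglyMeasurable 1 (.of_forall fun s => by
        rw [Real.norm_of_nonneg (weight_unit_nonneg s ω)]
        exact weight_unit_le_one s ω)
  rw [signalStateLaw, withDensity_apply _ hS, ← ofReal_integral_eq_lintegral_ofReal hi.integrableOn
    (.of_forall fun s => weight_unit_nonneg s ω),
    hτ.setIntegral_signalLaw_le (fun x => weight x ω) hb]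

theorem signalStateLaw_gt (hτ : IsPositiveDensity τ) {b : ℝ} (hb : b ∈ Icc (0 : ℝ) 1) (ω : Fin 2) :
    signalStateLaw τ ω {s | (s : ℝ) ≤ b}ᶜ =
      ENNReal.ofReal ((∫ x in (0 : ℝ)..1, weight x ω * τ x) -
        ∫ x in (0 : ℝ)..b, weight x ω * τ x) := by
  have hS : MeasurableSet {s : unitInterval | (s : ℝ) ≤ b} :=
    measurableSet_le measurable_subtype_coe measurable_const
  have := isFiniteMeasure_signalStateLaw hτ ω
  have h1 := hτ.signalStateLaw_le ⟨zero_le_one, le_rfl⟩ ω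
  have e : {s : unitInterval | (s : ℝ) ≤ 1} = univ := eq_univ_of_forall fun s => s.2.2
  rw [e] at h1
  rw [measure_compl hS (measure_ne_top _ _), h1, hτ.signalStateLaw_le hb, ENNReal.ofReal_sub]
  refine intervalIntegral.integral_nonneg hb.1 fun x hx => ?_
  exact mul_nonneg (weight_nonneg hx.1 (hx.2.trans hb.2) ω) (hτ.pos x ⟨hx.1, hx.2.trans hb.2⟩).le

theorem integral_weight_mul (hτ : IsPositiveDensity τ) {b : ℝ} (hb : b ∈ Icc (0 : ℝ) 1) :
    (∫ x in (0 : ℝ)..b, weight x 0 * τ x = cdfOf τ b - partialMean τ b) ∧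
    ∫ x in (0 : ℝ)..b, weight x 1 * τ x = partialMean τ b := by
  have hz : (0 : ℝ) ∈ Icc (0 : ℝ) 1 := ⟨le_rfl, zero_le_one⟩
  refine ⟨?_, rfl⟩
  simp only [weight_zero, sub_mul, one_mul]
  exact intervalIntegral.integral_sub (hτ.intervalIntegrable_of_mem hz hb)
    (hτ.intervalIntegrable_mul continuous_id hz hb)

end IsPositiveDensity

theorem bind_piecewise_const {X Y : Type*} [MeasurableSpace X] [MeasurableSpace Y]
    (ν : Measure X) {S : Set X} [DecidablePred (· ∈ S)] (hS : MeasurableSet S) (P Q : Measure Y) :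
    ν.bind (Kernel.piecewise hS (Kernel.const X P) (Kernel.const X Q)) = ν S • P + ν Sᶜ • Q := by
  ext E hE
  rw [Measure.bind_apply hE (Kernel.aemeasurable _)]
  have : ∀ x, Kernel.piecewise hS (Kernel.const X P) (Kernel.const X Q) x E =
      S.piecewise (fun _ => P E) (fun _ => Q E) x := fun x => by
    rw [Kernel.piecewise_apply]
    by_cases hx : x ∈ S <;> simp [hx]
  simp only [this]
  rw [lintegral_piecewise hS]
  simp [mul_comm]

/-- The adviser's strategy that keeps the agent indifferent: messages above `hi` and below `lo` are
sent, respectively, at beliefs up to and above `b`, just often enough to induce the beliefs `hi` and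
`lo`. -/
theorem exists_adviserStrategy {τ : ℝ → ℝ} (hτ : IsPositiveDensity τ) {α c lo hi b : ℝ}
    (hα0 : 0 ≤ α) (hα1 : α ≤ 1) (hc0 : 0 ≤ c) (hc1 : c ≤ 1) (hlo : lo ∈ Icc (0 : ℝ) 1)
    (hhi : hi ∈ Icc (0 : ℝ) 1) (hle : lo ≤ hi) (hb : b ∈ Icc (0 : ℝ) 1)
    (hKlo : 0 < lo * cdfOf τ lo - partialMean τ lo)
    (hKhi : 0 < (prior τ - partialMean τ hi) - hi * (1 - cdfOf τ hi))
    (hbal_lo : (1 - α) * c * ((prior τ - partialMean τ b) - lo * (1 - cdfOf τ b)) =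
      α * (lo * cdfOf τ lo - partialMean τ lo))
    (hbal_hi : (1 - α) * c * (hi * cdfOf τ b - partialMean τ b) =
      α * ((prior τ - partialMean τ hi) - hi * (1 - cdfOf τ hi)))
    (hc : c = 1 ∨ lo = prior τ ∧ hi = prior τ) (hpos : 0 < α ∨ c = 0) :
    ∃ β : AdviserStrategy, InducesBelief τ α β (clamp lo hi) ∧
      (∀ P : unitInterval → Prop,
        (∀ᵐ m ∂(messageLaw τ α β), P m) ↔ ∀ᵐ m ∂(signalLaw τ), P m) ∧
      (∀ s, β.1 s ≪ signalLaw τ) ∧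
      ∀ s : unitInterval, ∀ᵐ m ∂(β.1 s), clamp lo hi m = if (s : ℝ) ≤ b then hi else lo := by
  classical
  have hm := hτ.isPartialMoments
  set F := cdfOf τ
  set M := partialMean τ
  set μ₀ := prior τ
  set Klo := lo * F lo - M lo
  set Khi := (μ₀ - M hi) - hi * (1 - F hi)
  set ν := signalLaw τ
  let hup : unitInterval → ℝ := fun m => max ((m : ℝ) - hi) 0
  let hdn : unitInterval → ℝ := fun m => max (lo - (m : ℝ)) 0
  -- `dhi` is the message density at signals up to `b`, and `dlo` the one above `b`. The part `(m -
  -- hi)⁺` offsets the truthful excess. The remaining weight `1 - c` goes to messages drawn from the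
  -- signal law, independently of the signal; it is used only when both end points are the prior.
  let dhi : unitInterval → ℝ := fun m => c * (hup m / Khi) + (1 - c)
  let dlo : unitInterval → ℝ := fun m => c * (hdn m / Klo) + (1 - c)
  have hupc : Continuous hup := by fun_prop
  have hdnc : Continuous hdn := by fun_prop
  have hdhi : Measurable dhi := ((hupc.measurable.div_const _).const_mul c).add_const _
  have hdlo : Measurable dlo := ((hdnc.measurable.div_const _).const_mul c).add_const _
  have dhi_ge : ∀ m, 1 - c ≤ dhi m := fun m =>
    le_add_of_nonneg_left (mul_nonneg hc0 (div_nonneg (le_max_right _ _) hKhi.le))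
  have dlo_ge : ∀ m, 1 - c ≤ dlo m := fun m =>
    le_add_of_nonneg_left (mul_nonneg hc0 (div_nonneg (le_max_right _ _) hKlo.le))
  have hc1' : 0 ≤ 1 - c := sub_nonneg.2 hc1
  have hα1' : 0 ≤ 1 - α := sub_nonneg.2 hα1
  let Qhi : Measure unitInterval := ν.withDensity fun m => ENNReal.ofReal (dhi m)
  let Qlo : Measure unitInterval := ν.withDensity fun m => ENNReal.ofReal (dlo m)
  have hQhi : IsProbabilityMeasure Qhi := hτ.isProbabilityMeasure_mixture
    (fun m => le_max_right _ _) (hτ.integral_upper_part hhi) hKhi hc0 hc1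
  have hQlo : IsProbabilityMeasure Qlo := hτ.isProbabilityMeasure_mixture
    (fun m => le_max_right _ _) (hτ.integral_lower_part hlo) hKlo hc0 hc1
  have hS : MeasurableSet {s : unitInterval | (s : ℝ) ≤ b} :=
    measurableSet_le measurable_subtype_coe measurable_const
  let β : AdviserStrategy :=
    ⟨Kernel.piecewise hS (Kernel.const _ Qhi) (Kernel.const _ Qlo), inferInstance⟩
  have hβ : ∀ s : unitInterval, β.1 s = if (s : ℝ) ≤ b then Qhi else Qlo := fun s => by
    change Kernel.piecewise hS (Kernel.const _ Qhi) (Kernel.const _ Qlo) s = _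
    rw [Kernel.piecewise_apply, Kernel.const_apply, Kernel.const_apply]
    rfl
  have ho : (1 : ℝ) ∈ Icc (0 : ℝ) 1 := ⟨zero_le_one, le_rfl⟩
  -- The joint probability of each state with a signal up to `b`, and below it with a signal above
  -- `b`.
  let nhi : Fin 2 → ℝ := ![F b - M b, M b]
  let nlo : Fin 2 → ℝ := ![(1 - F b) - (μ₀ - M b), μ₀ - M b]
  have nhi_eq : ∀ ω, nhi ω = ∫ x in (0 : ℝ)..b, weight x ω * τ x := fun ω => by
    fin_cases ω
    · exact (hτ.integral_weight_mul hb).1.symm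
    · exact (hτ.integral_weight_mul hb).2.symm
  have nlo_eq : ∀ ω, nlo ω = (∫ x in (0 : ℝ)..1, weight x ω * τ x) -
      ∫ x in (0 : ℝ)..b, weight x ω * τ x := fun ω => by
    fin_cases ω
    · change _ = (∫ x in (0 : ℝ)..1, weight x 0 * τ x) - ∫ x in (0 : ℝ)..b, weight x 0 * τ x
      rw [(hτ.integral_weight_mul hb).1, (hτ.integral_weight_mul ho).1]
      change 1 - F b - (μ₀ - M b) = F 1 - M 1 - (F b - M b)
      rw [hm.F_one, hm.M_one]
      ring
    · rfl
  have b0 := hm.le_left le_rfl hb.1 hb.2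
  have b1 := hm.le_right le_rfl hb.1 hb.2
  have b2 := hm.le_left hb.1 hb.2 le_rfl
  have b3 := hm.le_right hb.1 hb.2 le_rfl
  have f1 := hm.F_le le_rfl hb.1 hb.2
  have f2 := hm.F_le hb.1 hb.2 le_rfl
  rw [hm.F_zero, hm.M_zero] at b0 b1
  rw [hm.F_one, hm.M_one] at b2 b3
  rw [hm.F_zero] at f1
  rw [hm.F_one] at f2
  have nhi_nonneg : ∀ ω, 0 ≤ nhi ω := fun ω => by
    fin_cases ω
    · change 0 ≤ F b - M b
      nlinarith [hb.2]
    · change 0 ≤ M b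
      linarith
  have nlo_nonneg : ∀ ω, 0 ≤ nlo ω := fun ω => by
    fin_cases ω
    · change 0 ≤ (1 - F b) - (μ₀ - M b)
      linarith
    · change 0 ≤ μ₀ - M b
      nlinarith [hb.1]
  let g : Fin 2 → unitInterval → ℝ := fun ω m =>
    α * weight m ω + (1 - α) * (nhi ω * dhi m + nlo ω * dlo m)
  have hgm : ∀ ω, Measurable (g ω) := fun ω =>
    (((continuous_weight ω).comp continuous_subtype_val).measurable.const_mul α).add
      (((hdhi.const_mul _).add (hdlo.const_mul _)).const_mul _)
  have hg : ∀ ω m, 0 ≤ g ω m := fun ω m => by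
    have h1 := hc1'.trans (dhi_ge m)
    have h2 := hc1'.trans (dlo_ge m)
    have h3 := nhi_nonneg ω
    have h4 := nlo_nonneg ω
    have h5 := weight_unit_nonneg m ω
    positivity
  have hlaw : ∀ ω, messageStateLaw τ α β ω = ν.withDensity fun m => ENNReal.ofReal (g ω m) := by
    intro ω
    have hw := measurable_ofReal_weight ω
    have e1 : (signalStateLaw τ ω).bind β.1 =
        ENNReal.ofReal (nhi ω) • Qhi + ENNReal.ofReal (nlo ω) • Qlo := by
      change (signalStateLaw τ ω).bind
        (Kernel.piecewise hS (Kernel.const _ Qhi) (Kernel.const _ Qlo)) = _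
      rw [bind_piecewise_const, hτ.signalStateLaw_le hb, hτ.signalStateLaw_gt hb, nhi_eq, nlo_eq]
    rw [messageStateLaw, bind_truthful, e1, signalStateLaw,
      ← withDensity_smul _ hdhi.ennreal_ofReal, ← withDensity_smul _ hdlo.ennreal_ofReal,
      ← withDensity_add_left (hdhi.ennreal_ofReal.const_smul _),
      ← withDensity_smul _ ((hdhi.ennreal_ofReal.const_smul _).add
        (hdlo.ennreal_ofReal.const_smul _)), ← withDensity_smul _ hw,
      ← withDensity_add_left (hw.const_smul _)]
    congr 1
    funext m
    have h3 := nhi_nonneg ω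
    have h4 := nlo_nonneg ω
    have h5 := weight_unit_nonneg m ω
    have hsplit : ∀ x y : ℝ, 0 ≤ x → 0 ≤ y →
        ENNReal.ofReal (α * weight m ω + (1 - α) * (nhi ω * x + nlo ω * y)) =
          ENNReal.ofReal α * ENNReal.ofReal (weight m ω) + ENNReal.ofReal (1 - α) *
            (ENNReal.ofReal (nhi ω) * ENNReal.ofReal x +
              ENNReal.ofReal (nlo ω) * ENNReal.ofReal y) := fun x y h1 h2 => by
      rw [ENNReal.ofReal_add (by positivity) (by positivity), ENNReal.ofReal_mul hα0,
        ENNReal.ofReal_mul hα1', ENNReal.ofReal_add (by positivity) (by positivity),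
        ENNReal.ofReal_mul h3, ENNReal.ofReal_mul h4]
    exact (hsplit _ _ (hc1'.trans (dhi_ge m)) (hc1'.trans (dlo_ge m))).symm
  obtain ⟨hsum, hind⟩ := inducesBelief_of_density hgm hg hlaw
  have hgsum : ∀ m, g 0 m + g 1 m = α + (1 - α) * (F b * dhi m + (1 - F b) * dlo m) := fun m => by
    change (α * (1 - (m : ℝ)) + (1 - α) * ((F b - M b) * dhi m + ((1 - F b) - (μ₀ - M b)) * dlo m)) +
      (α * (m : ℝ) + (1 - α) * (M b * dhi m + (μ₀ - M b) * dlo m)) = _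
    ring
  -- Strict positivity gives the message law and the signal law the same null sets. If `α = 0`, the
  -- independent messages, with weight `1 - c = 1`, provide it.
  have hgpos : ∀ m, 0 < g 0 m + g 1 m := fun m => by
    rw [hgsum]
    have : 1 - c ≤ F b * dhi m + (1 - F b) * dlo m := by
      nlinarith [mul_le_mul_of_nonneg_left (dhi_ge m) f1,
        mul_le_mul_of_nonneg_left (dlo_ge m) (sub_nonneg.2 f2)]
    rcases hpos with h | h
    · nlinarith [mul_nonneg hα1' (hc1'.trans this)]
    · subst h
      nlinarith [mul_le_mul_of_nonneg_left this hα1']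
  refine ⟨β, hind _ (continuous_clamp lo hi).measurable
    (fun m => ⟨hlo.1.trans (clamp_mem hle m).1, (clamp_mem hle m).2.trans hhi.2⟩) (fun m => ?_),
    fun P => ?_, fun s => ?_, fun s => ?_⟩
  · rw [hgsum]
    change α * (m : ℝ) + (1 - α) * (M b * dhi m + (μ₀ - M b) * dlo m) = _
    -- The independent messages carry the mean `μ₀`; they disturb no belief, since either they are
    -- absent or the projection is `μ₀` itself.
    have hmean : ∀ x ∈ Icc lo hi, (1 - c) * (μ₀ - x) = 0 := fun x hx => by
      rcases hc with h | ⟨h1, h2⟩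
      · simp [h]
      · have : x = μ₀ := le_antisymm (hx.2.trans h2.le) (h1.symm.le.trans hx.1)
        simp [this]
    have hmn := hmean _ (clamp_mem hle m)
    rcases le_total (m : ℝ) lo with h1 | h1
    · have e1 : dhi m = 1 - c := by
        simp only [dhi, hup, max_eq_right (sub_nonpos.2 (h1.trans hle)), zero_div, mul_zero,
          zero_add]
      have e2 : dlo m = c * ((lo - m) / Klo) + (1 - c) := by
        simp only [dlo, hdn, max_eq_left (sub_nonneg.2 h1)]
      rw [clamp_of_le h1] at hmn ⊢
      rw [e1, e2]
      -- By the balancing identity, the upward pull of the lies at `m` is exactly the shortfall of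
      -- the truthful message from `lo`.
      have e3 : (1 - α) * c * ((μ₀ - M b) - lo * (1 - F b)) * ((lo - m) / Klo) = α * (lo - m) := by
        rw [hbal_lo]; field_simp
      linear_combination e3 + (1 - α) * hmn
    · rcases le_total (m : ℝ) hi with h2 | h2
      · have e1 : dhi m = 1 - c := by
          simp only [dhi, hup, max_eq_right (sub_nonpos.2 h2), zero_div, mul_zero, zero_add]
        have e2 : dlo m = 1 - c := by
          simp only [dlo, hdn, max_eq_right (sub_nonpos.2 h1), zero_div, mul_zero, zero_add]
        rw [clamp_of_mem ⟨h1, h2⟩] at hmn ⊢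
        rw [e1, e2]
        linear_combination (1 - α) * hmn
      · have e1 : dlo m = 1 - c := by
          simp only [dlo, hdn, max_eq_right (sub_nonpos.2 h1), zero_div, mul_zero, zero_add]
        have e2 : dhi m = c * ((m - hi) / Khi) + (1 - c) := by
          simp only [dhi, hup, max_eq_left (sub_nonneg.2 h2)]
        rw [clamp_of_ge hle h2] at hmn ⊢
        rw [e1, e2]
        have e3 : (1 - α) * c * (hi * F b - M b) * ((m - hi) / Khi) = α * (m - hi) := by
          rw [hbal_hi]; field_simp
        linear_combination (1 - α) * hmn - e3
  · have hsm : Measurable fun m => g 0 m + g 1 m := (hgm 0).add (hgm 1)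
    rw [hsum, ae_withDensity_iff hsm.ennreal_ofReal]
    refine Filter.eventually_congr (.of_forall fun m => ?_)
    simp [hgpos m]
  · rw [hβ]
    split_ifs
    · exact withDensity_absolutelyContinuous _ _
    · exact withDensity_absolutelyContinuous _ _
  · rw [hβ]
    split_ifs
    · refine (ae_withDensity_iff hdhi.ennreal_ofReal).2 (.of_forall fun m hne => ?_)
      -- With `c = 1` the density vanishes up to `hi`; otherwise the projection is constant.
      rcases hc with h | ⟨h1, h2⟩
      · refine clamp_of_ge hle (le_of_lt ?_)
        by_contra! hlt
        refine hne ?_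
        simp [dhi, hup, h, max_eq_right (sub_nonpos.2 hlt)]
      · have := clamp_mem hle m
        exact le_antisymm this.2 ((h2.trans h1.symm).le.trans this.1)
    · refine (ae_withDensity_iff hdlo.ennreal_ofReal).2 (.of_forall fun m hne => ?_)
      rcases hc with h | ⟨h1, h2⟩
      · refine clamp_of_le (le_of_lt ?_)
        by_contra! hlt
        refine hne ?_
        simp [dlo, hdn, h, max_eq_right (sub_nonpos.2 hlt)]
      · have := clamp_mem hle m
        exact le_antisymm (this.2.trans (h2.trans h1.symm).le) this.1

/-! ### Trust regions and the saddle point argument. -/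

/-- The point of `[lo, hi] ⊆ [0, 1]` nearest to the message, as a message. -/
noncomputable def clampUnit {lo hi : ℝ} (h0 : 0 ≤ lo) (hle : lo ≤ hi) (h1 : hi ≤ 1)
    (m : unitInterval) : unitInterval :=
  ⟨clamp lo hi m, h0.trans (clamp_mem hle m).1, (clamp_mem hle m).2.trans h1⟩

theorem continuous_clampUnit {lo hi : ℝ} (h0 : 0 ≤ lo) (hle : lo ≤ hi) (h1 : hi ≤ 1) :
    Continuous (clampUnit h0 hle h1) :=
  (continuous_clamp lo hi).subtype_mk _

/-- A statement that holds almost everywhere holds somewhere in each nonempty open set. -/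
theorem exists_mem_of_ae_signalLaw {τ : ℝ → ℝ} (hτ : IsPositiveDensity τ)
    {P : unitInterval → Prop} (hP : ∀ᵐ m ∂(signalLaw τ), P m) {O : Set unitInterval}
    (hO : IsOpen O) (hne : O.Nonempty) : ∃ m ∈ O, P m := by
  rw [hτ.ae_signalLaw_iff] at hP
  by_contra! h
  have hnull : volume O = 0 := measure_mono_null (fun m hm => h m hm) hP
  obtain ⟨V, hV, rfl⟩ := isOpen_induced_iff.1 hO
  obtain ⟨m, hm⟩ := hne
  rw [unitInterval.volume_apply, Subtype.image_preimage_coe] at hnull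
  have hmem : (m : ℝ) ∈ closure (Ioo (0 : ℝ) 1) := by
    rw [closure_Ioo zero_ne_one]; exact m.2
  have hne' : (V ∩ Ioo (0 : ℝ) 1).Nonempty := mem_closure_iff.1 hmem V hV hm
  refine ((hV.inter isOpen_Ioo).measure_pos volume hne').ne' (measure_mono_null ?_ hnull)
  exact fun x hx => ⟨Ioo_subset_Icc_self hx.2, hx.1⟩

namespace DecisionProblem

section General

variable {A Θ : Type*} [TopologicalSpace A] [MeasurableSpace A] [MeasurableSpace Θ]
  {D : DecisionProblem A Θ} {τ : ℝ → ℝ} {α lo hi : ℝ} {β : AdviserStrategy} {σ σ' : Strategy A Θ}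

/-- By single crossing, the payoff at a message outside the interval is largest for the private
strategy of the nearest end point, so the projection serves as `P m`. -/
theorem isTrustRegionStrategy_of_clamp (h0 : 0 ≤ lo) (hle : lo ≤ hi) (h1 : hi ≤ 1)
    (hσ : ∀ m, D.BayesOptimal (σ.after m) (clamp lo hi m)) :
    D.IsTrustRegionStrategy σ (interval lo hi) := by
  refine ⟨(isClosed_Icc.preimage continuous_subtype_val).isCompact, fun m => ⟨fun hm => ?_,
    fun hm => ?_⟩⟩
  · have := hσ m
    rwa [clamp_of_mem hm] at this
  · have hT : ∀ m' ∈ interval lo hi, D.BayesOptimal (σ.after m') m' := fun m' hm' => by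
      have := hσ m'
      rwa [clamp_of_mem hm'] at this
    have hσm := hσ m
    rw [interval, mem_ofPred_eq, mem_Icc, not_and_or, not_le, not_le] at hm
    rcases hm with hm | hm
    · rw [clamp_of_le hm.le] at hσm
      have hp : (⟨lo, h0, hle.trans h1⟩ : unitInterval) ∈ interval lo hi := ⟨le_rfl, hle⟩
      refine ⟨_, hp, fun m' hm' => ?_, hσm⟩
      rcases hm'.1.eq_or_lt with he | hlt
      · rw [show m' = ⟨lo, h0, hle.trans h1⟩ from Subtype.ext he.symm]
      · exact payoff_le_payoff_of_lt_of_ge hlt hm.le (hT m' hm') (hT _ hp)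
    · rw [clamp_of_ge hle hm.le] at hσm
      have hp : (⟨hi, h0.trans hle, h1⟩ : unitInterval) ∈ interval lo hi := ⟨hle, le_rfl⟩
      refine ⟨_, hp, fun m' hm' => ?_, hσm⟩
      rcases hm'.2.eq_or_lt with he | hlt
      · rw [show m' = ⟨hi, h0.trans hle, h1⟩ from Subtype.ext he]
      · exact payoff_le_payoff_of_lt_of_le hlt hm.le (hT m' hm') (hT _ hp)

/-- If an agent acts on the message projected to `[lo, hi]`, each of its trust regions contains
`[lo, hi]`. -/
theorem Regular.interval_subset_of_isTrustRegionStrategy (hD : D.Regular)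
    (hτ : IsPositiveDensity τ) (h0 : 0 ≤ lo) (hle : lo ≤ hi) (h1 : hi ≤ 1)
    (hσ : ∀ᵐ m ∂(signalLaw τ), D.BayesOptimal (σ.after m) (clamp lo hi m))
    {T : Set unitInterval} (hT : D.IsTrustRegionStrategy σ T) : interval lo hi ⊆ T := by
  intro m₀ hm₀
  by_contra hmT
  -- Messages outside `T` whose projection is also outside `T` form an open set, which contains
  -- `m₀`. So it has a point with a strategy Bayes-optimal both for its projection and for some
  -- belief in `T`; the two beliefs coincide, a contradiction.
  have hopen : IsOpen (Tᶜ ∩ clampUnit h0 hle h1 ⁻¹' Tᶜ) :=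
    hT.1.isClosed.isOpen_compl.inter
      (hT.1.isClosed.isOpen_compl.preimage (continuous_clampUnit h0 hle h1))
  have hc : clampUnit h0 hle h1 m₀ = m₀ := Subtype.ext (clamp_of_mem hm₀)
  obtain ⟨m, ⟨hm, hcm⟩, hopt⟩ := exists_mem_of_ae_signalLaw hτ hσ hopen
    ⟨m₀, hmT, by rw [mem_preimage, hc]; exact hmT⟩
  obtain ⟨p, hp, -, hκ⟩ := (hT.2 m).2 hm
  refine hcm ?_
  have : clampUnit h0 hle h1 m = p :=
    Subtype.ext (hD.eq_of_bayesOptimal (clampUnit h0 hle h1 m).2 p.2 hopt hκ)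
  rw [this]
  exact hp

theorem bddBelow_expectedPayoff (hτ : IsPositiveDensity τ) (σ : Strategy A Θ) :
    BddBelow (range fun β : AdviserStrategy => D.expectedPayoff τ β σ) := by
  have := hτ.isProbabilityMeasure_signalLaw
  obtain ⟨C, hC⟩ := D.exists_bound_payoff
  refine ⟨-C, ?_⟩
  rintro _ ⟨β, rfl⟩
  have := β.2
  have hin : ∀ s : unitInterval, ‖∫ m, D.payoff (σ.after m) s ∂(β.1 s)‖ ≤ C := fun s => by
    simpa using norm_integral_le_of_norm_le_const (μ := β.1 s)
      (f := fun m => D.payoff (σ.after m) s) (C := C) (.of_forall fun m => hC _ _ s.2)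
  have h := norm_integral_le_of_norm_le_const (μ := signalLaw τ) (.of_forall hin)
  rw [probReal_univ, mul_one] at h
  exact (abs_le.1 h).1

/-- Saddle point: if the adviser's strategy `β` induces the projection of the message to `[lo, hi]`
and is adversarial against a strategy that is optimal for this projection, then the latter is
optimal, and all optimal strategies share these properties. -/
theorem optimal_of_saddle (hτ : IsPositiveDensity τ) (hα0 : 0 ≤ α) (hα1 : α ≤ 1) (h0 : 0 ≤ lo)
    (hle : lo ≤ hi) (h1 : hi ≤ 1) (hind : InducesBelief τ α β (clamp lo hi))
    (hae : ∀ P : unitInterval → Prop,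
      (∀ᵐ m ∂(messageLaw τ α β), P m) ↔ ∀ᵐ m ∂(signalLaw τ), P m)
    (hσ : ∀ m, D.BayesOptimal (σ.after m) (clamp lo hi m)) (hadv : D.Adversarial τ β σ) :
    D.Optimal τ α σ ∧ ∀ σ', D.Optimal τ α σ' →
      (∀ᵐ m ∂(signalLaw τ), D.BayesOptimal (σ'.after m) (clamp lo hi m)) ∧
      (α < 1 → D.Adversarial τ β σ') := by
  have hp01 : ∀ m, clamp lo hi m ∈ Icc (0 : ℝ) 1 := fun m =>
    ⟨h0.trans (clamp_mem hle m).1, (clamp_mem hle m).2.trans h1⟩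
  have hpm := (continuous_clamp lo hi).measurable
  have hint := fun σ' => hind.integral_payoff hτ hα0 hα1 hpm hp01 D σ'
  have hα1' : 0 ≤ 1 - α := sub_nonneg.2 hα1
  have hle_inf : ∀ σ' : Strategy A Θ,
      ⨅ β : AdviserStrategy, D.expectedPayoff τ β σ' ≤ D.expectedPayoff τ β σ' := fun σ' =>
    ciInf_le (D.bddBelow_expectedPayoff hτ σ') β
  -- The fixed strategy `β` bounds the worst case of every strategy by its average payoff at the
  -- induced beliefs.
  have hup : ∀ σ', D.worstCase τ α σ' ≤
      ∫ m, D.payoff (σ'.after m) (clamp lo hi m) ∂(messageLaw τ α β) := fun σ' => by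
    rw [← (hint σ').2, worstCase]
    have := mul_le_mul_of_nonneg_left (hle_inf σ') hα1'
    linarith
  have hmono : ∀ σ' : Strategy A Θ,
      ∫ m, D.payoff (σ'.after m) (clamp lo hi m) ∂(messageLaw τ α β) ≤
        ∫ m, D.payoff (σ.after m) (clamp lo hi m) ∂(messageLaw τ α β) := fun σ' =>
    integral_mono (hint σ').1 (hint σ).1 fun m => hσ m _
  have hinf : ⨅ β' : AdviserStrategy, D.expectedPayoff τ β' σ = D.expectedPayoff τ β σ := by
    have : Nonempty AdviserStrategy := ⟨β⟩
    exact le_antisymm (hle_inf σ) (le_ciInf hadv)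
  have hval : D.worstCase τ α σ =
      ∫ m, D.payoff (σ.after m) (clamp lo hi m) ∂(messageLaw τ α β) := by
    rw [← (hint σ).2, worstCase, hinf]
  refine ⟨fun σ' => (hup σ').trans ((hmono σ').trans hval.ge), fun σ' hopt => ⟨?_, fun hlt => ?_⟩⟩
  -- Equality of the values makes a nonnegative pointwise loss integrate to zero.
  · have heq : ∫ m, (D.payoff (σ.after m) (clamp lo hi m) - D.payoff (σ'.after m) (clamp lo hi m))
        ∂(messageLaw τ α β) = 0 := by
      rw [integral_sub (hint σ).1 (hint σ').1]
      linarith [hopt σ, hup σ', hmono σ']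
    rw [integral_eq_zero_iff_of_nonneg (fun m => sub_nonneg.2 (hσ m _))
      ((hint σ).1.sub (hint σ').1)] at heq
    rw [← hae]
    filter_upwards [heq] with m hm κ
    rw [← sub_eq_zero.1 hm]
    exact hσ m κ
  · intro β'
    have h2 := (hint σ').2
    have h3 := hopt σ
    have h4 := hmono σ'
    have h5 := D.bddBelow_expectedPayoff hτ σ'
    refine le_trans ?_ (ciInf_le h5 β')
    rw [hval] at h3
    rw [worstCase] at h3
    -- The truthful parts cancel; `β` is seen to attain the infimum only after dividing by `1 - α`.
    have h6 : (1 - α) * D.expectedPayoff τ β σ' ≤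
        (1 - α) * ⨅ β : AdviserStrategy, D.expectedPayoff τ β σ' := by linarith
    exact le_of_mul_le_mul_left h6 (sub_pos.2 hlt)

theorem robustlyRationalizable_of_induces (hτ : IsPositiveDensity τ) (h0 : 0 ≤ lo)
    (hle : lo ≤ hi) (h1 : hi ≤ 1) (hind : InducesBelief τ α β (clamp lo hi))
    (hae : ∀ P : unitInterval → Prop,
      (∀ᵐ m ∂(messageLaw τ α β), P m) ↔ ∀ᵐ m ∂(signalLaw τ), P m)
    (hσ : ∀ᵐ m ∂(signalLaw τ), D.BayesOptimal (σ.after m) (clamp lo hi m))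
    (hadv : D.Adversarial τ β σ) : D.RobustlyRationalizable τ α σ := by
  refine ⟨β, hadv, ?_⟩
  filter_upwards [(hae _).2 hσ, hind.posteriorBelief_ae_eq hτ (continuous_clamp lo hi).measurable
    fun m => ⟨h0.trans (clamp_mem hle m).1, (clamp_mem hle m).2.trans h1⟩] with m hm hpost
  rwa [hpost]

/-- The law of the message when the adviser is always truthful. -/
theorem messageLaw_one (β : AdviserStrategy) :
    messageLaw τ 1 β = signalLaw τ ∧ InducesBelief τ 1 β (clamp 0 1) := by
  have hlaw : ∀ ω, messageStateLaw τ 1 β ω =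
      (signalLaw τ).withDensity fun m => ENNReal.ofReal (weight m ω) := fun ω => by
    rw [messageStateLaw, bind_truthful, signalStateLaw]
    simp
  have h := inducesBelief_of_density (g := fun ω m => weight m ω)
    (fun ω => ((continuous_weight ω).comp continuous_subtype_val).measurable)
    (fun ω m => weight_unit_nonneg m ω) hlaw
  have hc : ∀ m, clamp 0 1 m = m := fun m => clamp_of_mem m.2
  refine ⟨?_, h.2 _ (continuous_clamp 0 1).measurable (fun m => by rw [hc]; exact m.2)
    fun m => ?_⟩
  · rw [h.1]
    simp [weight_zero, weight_one]
  · rw [hc, weight_zero, weight_one]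
    ring

/-- For the case of full trust. By single crossing, the payoff at a signal falls as the message
moves away from it, so the worse of the messages 0 and 1 is a worst message. -/
theorem exists_adversarial_of_bayesOptimal (hσ : ∀ m, D.BayesOptimal (σ.after m) m)
    (hτ : IsPositiveDensity τ) : ∃ β : AdviserStrategy, D.Adversarial τ β σ := by
  classical
  have := hτ.isProbabilityMeasure_signalLaw
  have hS : MeasurableSet {s : unitInterval |
      D.payoff (σ.after 0) s ≤ D.payoff (σ.after 1) s} := by
    simp only [payoff_eq]
    exact measurableSet_le (by fun_prop) (by fun_prop)
  let β : AdviserStrategy :=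
    ⟨Kernel.piecewise hS (Kernel.const _ (Measure.dirac 0)) (Kernel.const _ (Measure.dirac 1)),
      inferInstance⟩
  refine ⟨β, fun β' => ?_⟩
  refine integral_mono (D.integrable_payoff_kernel σ β _) (D.integrable_payoff_kernel σ β' _)
    fun s => ?_
  have hmin : ∀ m : unitInterval,
      min (D.payoff (σ.after 0) s) (D.payoff (σ.after 1) s) ≤ D.payoff (σ.after m) s := by
    intro m
    rcases le_total m s with hms | hms
    · rcases (unitInterval.nonneg' (t := m)).eq_or_lt with he | hlt
      · rw [← he]
        exact min_le_left _ _
      · exact (min_le_left _ _).trans (payoff_le_payoff_of_lt_of_le (D := D) hlt hms (hσ 0) (hσ m))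
    · rcases (unitInterval.le_one' (t := m)).eq_or_lt with he | hlt
      · rw [he]
        exact min_le_right _ _
      · exact (min_le_right _ _).trans
          (payoff_le_payoff_of_lt_of_ge (D := D) hlt hms (hσ 1) (hσ m))
  have hβ : ∫ m, D.payoff (σ.after m) s ∂(β.1 s) =
      min (D.payoff (σ.after 0) s) (D.payoff (σ.after 1) s) := by
    change ∫ m, _ ∂(Kernel.piecewise hS _ _ s) = _
    rw [Kernel.integral_piecewise]
    simp only [Kernel.const_apply, integral_dirac, mem_ofPred_eq]
    split_ifs with h
    · exact (min_eq_left h).symm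
    · exact (min_eq_right (not_le.1 h).le).symm
  simp only [hβ]
  have := β'.2
  obtain ⟨C, hC⟩ := D.exists_bound_payoff
  calc min (D.payoff (σ.after 0) s) (D.payoff (σ.after 1) s) =
        ∫ _, min (D.payoff (σ.after 0) s) (D.payoff (σ.after 1) s) ∂(β'.1 s) := by simp
    _ ≤ ∫ m, D.payoff (σ.after m) s ∂(β'.1 s) := by
        refine integral_mono (integrable_const _) ?_ hmin
        exact Integrable.of_bound ((D.measurable_payoff_after σ).comp
          measurable_prodMk_left).aestronglyMeasurable C (.of_forall fun m => hC _ _ s.2)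

end General

section Existence

variable {A Θ : Type*} [MetricSpace A] [CompactSpace A] [Nonempty A] [MeasurableSpace A]
  [BorelSpace A] [MeasurableSpace Θ] (D : DecisionProblem A Θ)

theorem exists_clamp_strategy {lo hi : ℝ} (h0 : 0 ≤ lo) (hle : lo ≤ hi) (h1 : hi ≤ 1) :
    ∃ σ : Strategy A Θ, ∀ m, D.BayesOptimal (σ.after m) (clamp lo hi m) := by
  obtain ⟨σ, hσ⟩ := D.exists_bayesOptimal_strategy
  have := σ.2
  have hm : Measurable fun p : unitInterval × Θ => (clampUnit h0 hle h1 p.1, p.2) :=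
    ((continuous_clampUnit h0 hle h1).measurable.comp measurable_fst).prodMk measurable_snd
  exact ⟨⟨σ.1.comap _ hm, inferInstance⟩, fun m => hσ (clampUnit h0 hle h1 m)⟩

end Existence

/-! ### Adversarial strategies against projection to an interior interval. -/

section Adversary

variable {A Θ : Type*} [TopologicalSpace A] [MeasurableSpace A] [MeasurableSpace Θ]
  {D : DecisionProblem A Θ} {τ : ℝ → ℝ} {α lo hi : ℝ} {β : AdviserStrategy} {σ : Strategy A Θ}

/-- Moving the point of tangency away from `x` lowers the tangent at `x`, so an end point of the
interval is worst. -/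
theorem Regular.min_tangent_le_payoff (hD : D.Regular) (h0 : 0 < lo) (hle : lo ≤ hi)
    (h1 : hi < 1) {κ : PrivateStrategy A Θ} {p : ℝ} (hp : p ∈ Icc lo hi)
    (hκ : D.BayesOptimal κ p) (x : ℝ) :
    min (D.tangent lo x) (D.tangent hi x) ≤ D.payoff κ x := by
  have hp1 : p ∈ Ioo (0 : ℝ) 1 := ⟨h0.trans_le hp.1, hp.2.trans_lt h1⟩
  rw [hD.payoff_eq_tangent hp1 hκ]
  have hpI := Ioo_subset_Icc_self hp1
  rcases le_total p x with h | h
  · exact (min_le_left _ _).trans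
      (hD.tangent_le_tangent_left ⟨h0.le, hle.trans h1.le⟩ hpI hp.1 h)
  · exact (min_le_right _ _).trans
      (hD.tangent_le_tangent_right ⟨h0.le.trans hle, h1.le⟩ hpI hp.2 h)

/-- Against a strategy that acts on the projected message, the adviser who sends messages projected
to `hi` at beliefs up to the threshold, and to `lo` above, holds the agent to the lower envelope of
the tangents at `lo` and `hi`. -/
theorem Regular.integral_payoff_eq_min_tangent (hD : D.Regular) (h0 : 0 < lo) (hle : lo ≤ hi)
    (h1 : hi < 1) (hac : ∀ s, β.1 s ≪ signalLaw τ)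
    (hcl : ∀ s : unitInterval, ∀ᵐ m ∂(β.1 s),
      clamp lo hi m = if (s : ℝ) ≤ D.threshold lo hi then hi else lo)
    (hσ : ∀ᵐ m ∂(signalLaw τ), D.BayesOptimal (σ.after m) (clamp lo hi m)) (s : unitInterval) :
    ∫ m, D.payoff (σ.after m) s ∂(β.1 s) = min (D.tangent lo s) (D.tangent hi s) := by
  have := β.2
  have hmin : ∀ᵐ m ∂(β.1 s), D.payoff (σ.after m) s = min (D.tangent lo s) (D.tangent hi s) := by
    filter_upwards [(hac s).ae_le hσ, hcl s] with m hm hms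
    rw [hms] at hm
    split_ifs at hm with hs
    · rw [hD.payoff_eq_tangent ⟨h0.trans_le hle, h1⟩ hm, min_eq_right
        (hD.tangent_hi_le h0.le hle h1.le hs)]
    · rw [hD.payoff_eq_tangent ⟨h0, hle.trans_lt h1⟩ hm, min_eq_left
        (hD.tangent_lo_le h0.le hle h1.le (not_le.1 hs).le)]
  rw [integral_congr_ae hmin]
  simp

theorem Regular.adversarial_of_clamp (hD : D.Regular) (hτ : IsPositiveDensity τ) (h0 : 0 < lo)
    (hle : lo ≤ hi) (h1 : hi < 1) (hac : ∀ s, β.1 s ≪ signalLaw τ)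
    (hcl : ∀ s : unitInterval, ∀ᵐ m ∂(β.1 s),
      clamp lo hi m = if (s : ℝ) ≤ D.threshold lo hi then hi else lo)
    (hσ : ∀ m, D.BayesOptimal (σ.after m) (clamp lo hi m)) : D.Adversarial τ β σ := by
  intro β'
  have := hτ.isProbabilityMeasure_signalLaw
  refine integral_mono (D.integrable_payoff_kernel σ β _) (D.integrable_payoff_kernel σ β' _)
    fun s => ?_
  have := β'.2
  obtain ⟨C, hC⟩ := D.exists_bound_payoff
  simp only [hD.integral_payoff_eq_min_tangent h0 hle h1 hac hcl (.of_forall hσ)]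
  calc min (D.tangent lo s) (D.tangent hi s) =
        ∫ _, min (D.tangent lo s) (D.tangent hi s) ∂(β'.1 s) := by simp
    _ ≤ ∫ m, D.payoff (σ.after m) s ∂(β'.1 s) := by
        refine integral_mono (integrable_const _) ?_ fun m =>
          hD.min_tangent_le_payoff h0 hle h1 (clamp_mem hle m) (hσ m) s
        exact Integrable.of_bound ((D.measurable_payoff_after σ).comp
          measurable_prodMk_left).aestronglyMeasurable C (.of_forall fun m => hC _ _ s.2)

/-- If `β` is adversarial, the agent trusts no message outside `[lo, hi]`: the adviser could send
it at beliefs near the threshold. -/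
theorem Regular.mem_interval_of_adversarial (hD : D.Regular) (hτ : IsPositiveDensity τ)
    (h0 : 0 < lo) (hle : lo ≤ hi) (h1 : hi < 1) (hac : ∀ s, β.1 s ≪ signalLaw τ)
    (hcl : ∀ s : unitInterval, ∀ᵐ m ∂(β.1 s),
      clamp lo hi m = if (s : ℝ) ≤ D.threshold lo hi then hi else lo)
    (hσ : ∀ᵐ m ∂(signalLaw τ), D.BayesOptimal (σ.after m) (clamp lo hi m))
    (hadv : D.Adversarial τ β σ) {m₀ : unitInterval} (hm₀ : D.BayesOptimal (σ.after m₀) m₀) :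
    m₀ ∈ interval lo hi := by
  classical
  by_contra hT
  have := hτ.isProbabilityMeasure_signalLaw
  have hlt := hD.payoff_threshold_lt h0.le hle h1.le m₀.2 hT hm₀
  let V : unitInterval → ℝ := fun s => min (D.tangent lo s) (D.tangent hi s)
  have hVc : Continuous V := by
    simp only [V, tangent]
    fun_prop
  have hPc : Continuous fun s : unitInterval => D.payoff (σ.after m₀) s := by
    simp only [payoff_eq]
    fun_prop
  have hO : IsOpen {s : unitInterval | D.payoff (σ.after m₀) s < V s} := isOpen_lt hPc hVc
  -- The deviation sends the single message `m₀` on the open set of signals where it hurts more.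
  -- That set contains the threshold, so it has positive mass and the gain is strict, even though
  -- `m₀` alone may be a null event.
  let β' : AdviserStrategy :=
    ⟨Kernel.piecewise hO.measurableSet (Kernel.const _ (Measure.dirac m₀)) β.1, by
      have := β.2
      infer_instance⟩
  have hβ := hD.integral_payoff_eq_min_tangent h0 hle h1 hac hcl hσ
  have hβ' : ∀ s : unitInterval, ∫ m, D.payoff (σ.after m) s ∂(β'.1 s) =
      min (D.payoff (σ.after m₀) s) (V s) := fun s => by
    change ∫ m, _ ∂(Kernel.piecewise hO.measurableSet _ _ s) = _
    rw [Kernel.integral_piecewise]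
    simp only [Kernel.const_apply, integral_dirac, mem_ofPred_eq, hβ]
    split_ifs with h
    · exact (min_eq_left h.le).symm
    · exact (min_eq_right (not_lt.1 h)).symm
  have hi1 := D.integrable_payoff_kernel σ β (signalLaw τ)
  have hi2 := D.integrable_payoff_kernel σ β' (signalLaw τ)
  have hle' := hadv β'
  simp only [expectedPayoff, hβ, hβ'] at hle' hi1 hi2
  have hz : ∫ s, (V s - min (D.payoff (σ.after m₀) s) (V s)) ∂(signalLaw τ) = 0 := by
    refine le_antisymm ?_ (integral_nonneg fun s => sub_nonneg.2 (min_le_right _ _))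
    rw [integral_sub hi1 hi2]
    exact sub_nonpos.2 hle'
  rw [integral_eq_zero_iff_of_nonneg (fun s => sub_nonneg.2 (min_le_right _ _))
    (hi1.sub hi2)] at hz
  have hb := hD.threshold_mem_unit h0.le hle h1.le
  obtain ⟨s, hs, hs0⟩ := exists_mem_of_ae_signalLaw hτ hz hO
    ⟨⟨D.threshold lo hi, hb⟩, by
      simpa [V, ← hD.tangent_threshold h0.le hle h1.le] using hlt⟩
  have hs' : D.payoff (σ.after m₀) s < V s := hs
  have hs1 : V s - min (D.payoff (σ.after m₀) s) (V s) = 0 := hs0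
  rw [min_eq_left hs'.le] at hs1
  linarith

end Adversary

/-! ### The trust interval for each degree of alignment. -/

section Region

variable {A Θ : Type*} [TopologicalSpace A] [MeasurableSpace A] [MeasurableSpace Θ]
  {D : DecisionProblem A Θ} {τ : ℝ → ℝ} {α : ℝ}

/-- For `α < 1` there are a region and an adviser's strategy that keeps the agent indifferent. -/
theorem Regular.exists_region (hD : D.Regular) (hτ : IsPositiveDensity τ) (hα0 : 0 ≤ α)
    (hα1 : α < 1) :
    ∃ lo hi, 0 < lo ∧ lo ≤ prior τ ∧ prior τ ≤ hi ∧ hi < 1 ∧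
      (α ≤ 1 / 2 → lo = prior τ ∧ hi = prior τ) ∧ (1 / 2 < α → D.Balanced τ α lo hi) ∧
      ∃ β : AdviserStrategy, InducesBelief τ α β (clamp lo hi) ∧
        (∀ P : unitInterval → Prop,
          (∀ᵐ m ∂(messageLaw τ α β), P m) ↔ ∀ᵐ m ∂(signalLaw τ), P m) ∧
        (∀ s, β.1 s ≪ signalLaw τ) ∧
        ∀ s : unitInterval, ∀ᵐ m ∂(β.1 s),
          clamp lo hi m = if (s : ℝ) ≤ D.threshold lo hi then hi else lo := by
  have hm := hτ.isPartialMoments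
  have hp0 := hm.mean_pos
  have hp1 := hm.mean_lt_one
  have hp : prior τ ∈ Icc (0 : ℝ) 1 := ⟨hp0.le, hp1.le⟩
  have h1α : 0 < 1 - α := sub_pos.2 hα1
  rcases le_or_gt α (1 / 2) with hα | hα
  · have hK := hm.half_excess_pos
    -- The share `c = α / (1 - α)` of lies offsets the truthful messages; it is at most 1 exactly
    -- when `α ≤ 1/2`.
    have hc : (1 - α) * (α / (1 - α)) = α := mul_div_cancel₀ _ h1α.ne'
    refine ⟨prior τ, prior τ, hp0, le_rfl, le_rfl, hp1, fun _ => ⟨rfl, rfl⟩,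
      fun h => absurd h (not_lt.2 hα), ?_⟩
    refine exists_adviserStrategy hτ (c := α / (1 - α)) hα0 hα1.le (by positivity)
      ((div_le_one h1α).2 (by linarith)) hp hp le_rfl (hD.threshold_mem_unit hp0.le le_rfl hp1.le)
      hK (by linarith) ?_ ?_ (Or.inr ⟨rfl, rfl⟩) ?_
    · rw [threshold_self, hc]
      ring
    · rw [threshold_self, hc]
      ring
    · rcases hα0.eq_or_lt with h | h
      · right
        rw [← h, zero_div]
      · exact Or.inl h
  · obtain ⟨lo, hi, h0, hlo, hhi, h1, el, eu⟩ := hD.exists_zero_excess hm hα hα1.le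
    have hle := hlo.le.trans hhi.le
    have hb := hD.threshold_mem_Ioo h0 (hlo.trans hhi) h1
    have hbI := hD.threshold_mem_unit h0 hle h1
    -- With `lo = 0` the low messages would have to induce belief 0, but they include lies told at
    -- signals above `b < 1`, whose mean is positive.
    have h0' : 0 < lo := by
      refine h0.lt_of_ne fun he => ?_
      have := hm.M_lt hbI.1 (hb.2.trans_le h1) le_rfl
      rw [hm.M_one] at this
      rw [lowerExcess, ← he, hm.M_zero] at el
      rw [← he] at this
      nlinarith
    have h1' : hi < 1 := by
      refine h1.lt_of_ne fun he => ?_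
      have := hm.lt_right 0 _ le_rfl (h0.trans_lt hb.1) hbI.2
      have hF := hm.F_lt le_rfl (h0.trans_lt hb.1) hbI.2
      rw [hm.M_zero, hm.F_zero] at this
      rw [hm.F_zero] at hF
      rw [upperExcess, he, hm.M_one, hm.F_one] at eu
      rw [he] at this hF
      have hbl : D.threshold lo 1 ≤ 1 := by rw [← he]; exact hb.2.le
      have : 0 < (1 - α) * (cdfOf τ (D.threshold lo 1) - partialMean τ (D.threshold lo 1)) :=
        mul_pos h1α (by nlinarith)
      linarith
    have hKlo := hm.lt_right 0 lo le_rfl h0' (hle.trans h1)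
    have hKhi := hm.lt_left hi 1 (h0.trans hle) h1' le_rfl
    rw [hm.M_zero, hm.F_zero] at hKlo
    rw [hm.M_one, hm.F_one] at hKhi
    refine ⟨lo, hi, h0', hlo.le, hhi.le, h1', fun h => absurd hα (not_lt.2 h),
      fun _ => (hD.balanced_iff hτ h0 hle h1).2 ⟨el, eu⟩, ?_⟩
    rw [lowerExcess] at el
    rw [upperExcess] at eu
    exact exists_adviserStrategy hτ (c := 1) hα0 hα1.le zero_le_one le_rfl ⟨h0, hle.trans h1⟩
      ⟨h0.trans hle, h1⟩ hle hbI (by linarith) (by linarith) (by linarith) (by linarith)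
      (Or.inl rfl) (Or.inl (by linarith))

theorem Regular.balanced_one (hD : D.Regular) (hτ : IsPositiveDensity τ) :
    D.Balanced τ 1 0 1 := by
  have hm := hτ.isPartialMoments
  rw [hD.balanced_iff hτ le_rfl zero_le_one le_rfl]
  simp [lowerExcess, upperExcess, hm.M_zero, hm.M_one, hm.F_one]

theorem Regular.balanced_unique (hD : D.Regular) (hτ : IsPositiveDensity τ) (hα0 : 0 < α)
    (hα1 : α ≤ 1) {lo hi lo' hi' : ℝ} (h0 : 0 ≤ lo) (hle : lo ≤ hi) (h1 : hi ≤ 1) (h0' : 0 ≤ lo')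
    (hle' : lo' ≤ hi') (h1' : hi' ≤ 1) (hbal : D.Balanced τ α lo hi)
    (hbal' : D.Balanced τ α lo' hi') : lo' = lo ∧ hi' = hi := by
  rw [hD.balanced_iff hτ h0 hle h1] at hbal
  rw [hD.balanced_iff hτ h0' hle' h1'] at hbal'
  exact hD.unique_zero_excess hτ.isPartialMoments hα0 hα1 h0 hle h1 h0' hle' h1' hbal.1 hbal.2
    hbal'.1 hbal'.2

end Region

/-! ### Assembly of the cases `α < 1` and `α = 1`. -/

section Main

variable {A Θ : Type*} [MetricSpace A] [CompactSpace A] [Nonempty A] [MeasurableSpace A]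
  [BorelSpace A] [MeasurableSpace Θ] {D : DecisionProblem A Θ} {τ : ℝ → ℝ} {α : ℝ}

/-- The trust interval, together with what optimality of a strategy means in terms of it. -/
theorem Regular.exists_trust_interval (hD : D.Regular) (hτ : IsPositiveDensity τ) (hα0 : 0 ≤ α)
    (hα1 : α ≤ 1) :
    ∃ lo hi : ℝ, 0 ≤ lo ∧ lo ≤ prior τ ∧ prior τ ≤ hi ∧ hi ≤ 1 ∧
      (α ≤ 1 / 2 → lo = prior τ ∧ hi = prior τ) ∧ (1 / 2 < α → D.Balanced τ α lo hi) ∧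
      (∃ σ : Strategy A Θ, D.Optimal τ α σ ∧ D.RobustlyRationalizable τ α σ ∧
        ∀ m, D.BayesOptimal (σ.after m) (clamp lo hi m)) ∧
      (∀ᵐ m ∂(signalLaw τ), clamp lo hi m ∈ Ioo 0 1) ∧
      ∀ σ : Strategy A Θ, D.Optimal τ α σ →
        (α < 1 → D.RobustlyRationalizable τ α σ) ∧
        (∀ᵐ m ∂(signalLaw τ), D.BayesOptimal (σ.after m) (clamp lo hi m)) ∧
        ∀ m : unitInterval, D.BayesOptimal (σ.after m) m → m ∈ interval lo hi := by
  rcases hα1.lt_or_eq with hlt | rfl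
  · obtain ⟨lo, hi, h0, hlo, hhi, h1, hhalf, hbal, β, hind, hae, hac, hcl⟩ :=
      hD.exists_region hτ hα0 hlt
    have hle := hlo.trans hhi
    obtain ⟨σ, hσ⟩ := D.exists_clamp_strategy h0.le hle h1.le
    have hadv := hD.adversarial_of_clamp hτ h0 hle h1 hac hcl hσ
    obtain ⟨hopt, hall⟩ := optimal_of_saddle hτ hα0 hα1 h0.le hle h1.le hind hae hσ hadv
    have hrr := fun (σ : Strategy A Θ) => robustlyRationalizable_of_induces (D := D) (σ := σ) hτ
      h0.le hle h1.le hind hae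
    refine ⟨lo, hi, h0.le, hlo, hhi, h1.le, hhalf, hbal,
      ⟨σ, hopt, hrr σ (.of_forall hσ) hadv, hσ⟩,
      .of_forall fun m => ⟨h0.trans_le (clamp_mem hle m).1, (clamp_mem hle m).2.trans_lt h1⟩,
      fun σ' hσ' => ⟨fun _ => hrr σ' (hall σ' hσ').1 ((hall σ' hσ').2 hlt), (hall σ' hσ').1,
        fun m hm => ?_⟩⟩
    exact hD.mem_interval_of_adversarial hτ h0 hle h1 hac hcl (hall σ' hσ').1
      ((hall σ' hσ').2 hlt) hm
  -- For `α = 1` the message law does not depend on `β`, so any adversarial strategy completes the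
  -- saddle point. The interval `[0, 1]` touches the extreme beliefs, and the projection is interior
  -- only almost everywhere.
  · have hm := hτ.isPartialMoments
    obtain ⟨σ, hσ⟩ := D.exists_clamp_strategy le_rfl zero_le_one le_rfl
    have hc : ∀ m, clamp 0 1 m = m := fun m => clamp_of_mem m.2
    obtain ⟨β, hadv⟩ := exists_adversarial_of_bayesOptimal
      (fun m => by have := hσ m; rwa [hc] at this) hτ
    obtain ⟨hlaw, hind⟩ := messageLaw_one (τ := τ) β
    have hae : ∀ P : unitInterval → Prop,
        (∀ᵐ m ∂(messageLaw τ 1 β), P m) ↔ ∀ᵐ m ∂(signalLaw τ), P m := fun P => by rw [hlaw]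
    obtain ⟨hopt, hall⟩ := optimal_of_saddle hτ zero_le_one le_rfl le_rfl zero_le_one le_rfl
      hind hae hσ hadv
    refine ⟨0, 1, le_rfl, hm.mean_pos.le, hm.mean_lt_one.le, le_rfl,
      fun h => absurd h (by norm_num), fun _ => hD.balanced_one hτ,
      ⟨σ, hopt, robustlyRationalizable_of_induces hτ le_rfl zero_le_one le_rfl hind hae
        (.of_forall hσ) hadv, hσ⟩, ?_,
      fun σ' hσ' => ⟨fun h => absurd h (lt_irrefl _), (hall σ' hσ').1, fun m _ => m.2⟩⟩
    rw [hτ.ae_signalLaw_iff]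
    filter_upwards [Measure.ae_ne volume (0 : unitInterval),
      Measure.ae_ne volume (1 : unitInterval)] with m h0 h1
    rw [hc]
    exact ⟨unitInterval.pos_iff_ne_zero.2 h0, unitInterval.lt_one_iff_ne_one.2 h1⟩

end Main

end DecisionProblem

end TrustRegion

theorem mainTheorem4 {A Θ : Type*}
    [MetricSpace A] [CompactSpace A] [Nonempty A] [MeasurableSpace A] [BorelSpace A]
    [MetricSpace Θ] [CompactSpace Θ] [MeasurableSpace Θ] [BorelSpace Θ]
    (D : TrustRegion.DecisionProblem A Θ)
    (hconv : StrictConvexOn ℝ (Icc 0 1) D.indirect)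
    (hdiff : DifferentiableOn ℝ D.indirect (Icc 0 1))
    (hdiff' : DifferentiableOn ℝ D.indirect' (Icc 0 1))
    (τ : ℝ → ℝ) (hτ : TrustRegion.IsPositiveDensity τ)
    (α : ℝ) (hα0 : 0 ≤ α) (hα1 : α ≤ 1) :
    ∃ lo hi : ℝ, 0 ≤ lo ∧ lo ≤ TrustRegion.prior τ ∧ TrustRegion.prior τ ≤ hi ∧ hi ≤ 1 ∧
      -- the trust interval
      (α ≤ 1 / 2 → lo = TrustRegion.prior τ ∧ hi = TrustRegion.prior τ) ∧
      (1 / 2 < α → D.Balanced τ α lo hi ∧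
        ∀ lo' hi' : ℝ, 0 ≤ lo' → lo' ≤ TrustRegion.prior τ → TrustRegion.prior τ ≤ hi' →
          hi' ≤ 1 → D.Balanced τ α lo' hi' → lo' = lo ∧ hi' = hi) ∧
      -- for `α < 1` the quotients in the balancing conditions are well defined
      (α < 1 → ∀ lo' hi' : ℝ, 0 ≤ lo' → lo' ≤ TrustRegion.prior τ → TrustRegion.prior τ ≤ hi' →
        hi' ≤ 1 → 0 < D.den₁ τ α lo' hi' ∧ 0 < D.den₂ τ α lo' hi') ∧
      -- existence, robust rationalizability
      (∃ σ : TrustRegion.Strategy A Θ, D.Optimal τ α σ ∧ D.RobustlyRationalizable τ α σ ∧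
        D.IsTrustRegionStrategy σ (TrustRegion.interval lo hi)) ∧
      (α < 1 → ∀ σ : TrustRegion.Strategy A Θ, D.Optimal τ α σ →
        D.RobustlyRationalizable τ α σ) ∧
      -- the trust region of an optimal strategy is unique
      (∀ σ : TrustRegion.Strategy A Θ, D.Optimal τ α σ → ∀ T : Set unitInterval,
        D.IsTrustRegionStrategy σ T → T = TrustRegion.interval lo hi) ∧
      -- every optimal strategy acts on the message projected to the trust interval
      (∀ σ : TrustRegion.Strategy A Θ, D.Optimal τ α σ →
        ∀ᵐ m ∂(TrustRegion.signalLaw τ), D.BayesOptimal (σ.after m) (max lo (min hi (m : ℝ)))) ∧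
      -- uniqueness: up to ties in payoffs in general, and outright when Bayes-optimal private
      -- strategies are unique
      (∀ σ σ' : TrustRegion.Strategy A Θ, D.Optimal τ α σ → D.Optimal τ α σ' →
        ∀ᵐ m ∂(TrustRegion.signalLaw τ), D.profile (σ.after m) = D.profile (σ'.after m)) ∧
      (D.UniqueBayesOptimal → ∀ σ σ' : TrustRegion.Strategy A Θ,
        D.Optimal τ α σ → D.Optimal τ α σ' →
        ∀ᵐ m ∂(TrustRegion.signalLaw τ), D.SamePrivate (σ.after m) (σ'.after m)) := by
  have hD : D.Regular := ⟨hconv, hdiff, hdiff'⟩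
  obtain ⟨lo, hi, h0, hlo, hhi, h1, hhalf, hbal, ⟨σ₀, hopt, hrr, hσ₀⟩, hint, hall⟩ :=
    hD.exists_trust_interval hτ hα0 hα1
  have hle := hlo.trans hhi
  refine ⟨lo, hi, h0, hlo, hhi, h1, hhalf, fun hα => ⟨hbal hα, fun lo' hi' h0' hlo' hhi' h1' hb =>
      hD.balanced_unique hτ (by linarith) hα1 h0 hle h1 h0' (hlo'.trans hhi') h1' (hbal hα) hb⟩,
    fun hα lo' hi' h0' hlo' hhi' h1' => hD.den_pos hτ hα0 hα h0' hlo' hhi' h1',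
    ⟨σ₀, hopt, hrr, TrustRegion.DecisionProblem.isTrustRegionStrategy_of_clamp h0 hle h1 hσ₀⟩,
    fun hα σ hσ => (hall σ hσ).1 hα, fun σ hσ T hT => ?_, fun σ hσ => (hall σ hσ).2.1,
    fun σ σ' hσ hσ' => ?_, fun huniq σ σ' hσ hσ' => ?_⟩
  -- A message in `T` is trusted, hence in the interval; the reverse inclusion rests on strict
  -- convexity and compactness of `T`.
  · exact Subset.antisymm (fun m hm => (hall σ hσ).2.2 m ((hT.2 m).1 hm))
      (hD.interval_subset_of_isTrustRegionStrategy hτ h0 hle h1 (hall σ hσ).2.1 hT)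
  -- At an interior projection the tangent fixes the payoff in both states, even when several
  -- private strategies are Bayes-optimal.
  · filter_upwards [hint, (hall σ hσ).2.1, (hall σ' hσ').2.1] with m hm h h'
    exact TrustRegion.DecisionProblem.profile_eq_of_payoff_eq fun x => by
      rw [hD.payoff_eq_tangent hm h, hD.payoff_eq_tangent hm h']
  · filter_upwards [hint, (hall σ hσ).2.1, (hall σ' hσ').2.1] with m hm h h'
    exact huniq _ hm _ _ h h'
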